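/- **Setting.** A finite square complex $T$ consists of a finite simple graph (its 0-cells and 1-cells) together with finitely many 2-cells (squares), each with boundary a 4-cycle on four distinct vertices; in each square one of the two diagonals is fixed, which cuts it into two triangles. A map $I$ from the vertices to $\mathbb{R}^3$ is extended to edges and squares by linear interpolation on edges and triangles. For $t,\ell\in\mathbb R$, $I$ is called a *$(t,\ell)$-embedding* if (bounded density) every closed ball of radius $1$ in $\mathbb{R}^3$ meets the images of at most $t$ squares, and (geometric locality) adjacent vertices are mapped to points at distance at most $\ell$. A *cap system* with $A$ labels consists of positive integers $\alpha,\alpha_1,\alpha_2$ with $1<2\alpha_2<\alpha$ and $\alpha\bigl(1-\cos\frac{\alpha_2}{\alpha}\bigr)>1$, and of $A$ labelled spherical caps of arc length (geodesic diameter) $\alpha_1$ on the sphere of radius $\alpha$ in $\mathbb{R}^3$, points of different caps being at arc distance at least $2\alpha_2$. A labelling of the vertices of $T$ by the $A$ labels is *proper* if adjacent vertices have different labels and the two ends of each chosen diagonal have different labels. **Statement.** Let $z_v,z_e$ be non-negative integers. There are an integer $A>1$, a cap system with $A$ labels and a real $t_0>0$, all depending only on $z_v,z_e$, such that for all real $t'$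 and $t$ with $t_0\le t'<t$ there is $\lambda_0\ge 1$, depending only on $z_v,z_e,t,t'$ and the cap system, with the following property for every $\lambda\ge\lambda_0$ and $\ell:=(2\alpha+1)\lambda>1$. Let $T$ be any finite square complex in which each vertex lies on at most $z_v$ edges and each edge on at most $z_e$ squares, and let $I$ be a $(t,1)$-embedding of $T$. Then $T$ has a proper labelling such that, if to each vertex $v$ one assigns independently a vector $c(v)$ distributed uniformly in the cap with the label of $v$ scaled by $\lambda$ (a cap on the sphere of radius $\alpha\lambda$), the map $$I'(v)=\lambda I(v)+c(v)$$ is a $(t',\ell)$-embedding of $T$ with positive probability. In particular there are vectors $c(v)$ in these scaled caps for which $I'$ is a $(t',\ell)$-embedding. The constants do not depend on $T$ or $I$; in particular, when this is applied to Tanner square complexes $T_{(i)}$, $i\ge 0$, with $z_v=7$ and $z_e=4$, they are independent of $i$. -/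

import Mathlib

open MeasureTheory

noncomputable section

/-- Euclidean three-space. -/
abbrev E3 : Type := EuclideanSpace ℝ (Fin 3)

/-- A square complex with 0-cells `V` and 2-cells `F`. Its 1-cells are the edges of the simple
graph `graph` (not every edge need lie on a 2-cell). The boundary of the 2-cell `f` is the 4-cycle
`corner f 0, corner f 1, corner f 2, corner f 3` on four distinct vertices. The auxiliary diagonal
of `f` joins `corner f 0` and `corner f 2`; as the cyclic labelling of the corners may start at
any vertex, the choice of the diagonal in each square is arbitrary. -/
structure SquareComplex (V F : Type*) where
  graph : SimpleGraph V
  corner : F → Fin 4 → V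
  corner_injective : ∀ f, Function.Injective (corner f)
  corner_adj : ∀ f i, graph.Adj (corner f i) (corner f (i + 1))

namespace SquareComplex

variable {V F : Type*} (T : SquareComplex V F)

/-- The square `f` is incident to the edge `{u, w}`. -/
def Incident (f : F) (u w : V) : Prop :=
  ∃ i : Fin 4, s(T.corner f i, T.corner f (i + 1)) = s(u, w)

/-- Every vertex lies on at most `zv` edges and every edge lies on at most `ze` squares. -/
def DegreesLE (zv ze : ℕ) : Prop :=
  (∀ v, (T.graph.neighborSet v).ncard ≤ zv) ∧
    ∀ u w, T.graph.Adj u w → {f | T.Incident f u w}.ncard ≤ ze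

/-- The image of the square `f` under the piecewise-linear extension of the vertex map `I`: the
two triangles into which the diagonal cuts the square are mapped by linear interpolation. -/
def cellImage (I : V → E3) (f : F) : Set E3 :=
  convexHull ℝ {I (T.corner f 0), I (T.corner f 1), I (T.corner f 2)} ∪
    convexHull ℝ {I (T.corner f 0), I (T.corner f 2), I (T.corner f 3)}

/-- The map determined by `I` on the vertices is a `(t, ℓ)`-embedding. Injectivity is not
required. -/
structure IsEmbedding (I : V → E3) (t ℓ : ℝ) : Prop where
  /-- Bounded density: every unit ball meets the images of at most `t` squares. -/
  density : ∀ x : E3,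
    ({f | (T.cellImage I f ∩ Metric.closedBall x 1).Nonempty}.ncard : ℝ) ≤ t
  /-- Geometric locality: neighbouring vertices are mapped to points at distance at most `ℓ`. -/
  locality : ∀ u w, T.graph.Adj u w → dist (I u) (I w) ≤ ℓ

/-- A labelling of the vertices such that no simplex of the complex with added diagonals has two
vertices with the same label (a triangle has this property once its three sides do). -/
def IsProperLabelling {A : ℕ} (lab : V → Fin A) : Prop :=
  (∀ u w, T.graph.Adj u w → lab u ≠ lab w) ∧
    ∀ f, lab (T.corner f 0) ≠ lab (T.corner f 2)

end SquareComplex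

/-- The closed spherical cap with the given axis on the sphere of radius `α`, of arc length
(diameter along the sphere) `α₁`; it is recorded by the directions, on the unit sphere, of its
points. -/
def sphericalCap (α α₁ : ℝ) (axis : Metric.sphere (0 : E3) 1) : Set (Metric.sphere (0 : E3) 1) :=
  {p | α * InnerProductGeometry.angle (p : E3) (axis : E3) ≤ α₁ / 2}

/-- The data of `A` labelled caps of arc length `α₁` on the sphere of radius `α` in `ℝ³`, any two
of them separated by arc distance at least `2 α₂`. (Scaling everything by `lam` gives caps of arc
length `α₁ * lam` on the sphere of radius `α * lam`, separated by `2 * α₂ * lam`.) -/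
structure CapSystem (A : ℕ) where
  α : ℕ
  α₁ : ℕ
  α₂ : ℕ
  α₁_pos : 0 < α₁
  one_lt : 1 < 2 * α₂
  lt_radius : 2 * α₂ < α
  /-- Positivity of the width parameter `γ = α (1 - cos (α₂ / α)) - 1`. -/
  γ_pos : 0 < (α : ℝ) * (1 - Real.cos ((α₂ : ℝ) / α)) - 1
  axis : Fin A → Metric.sphere (0 : E3) 1
  separated : ∀ i j, i ≠ j → ∀ p ∈ sphericalCap α α₁ (axis i), ∀ q ∈ sphericalCap α α₁ (axis j),
    2 * (α₂ : ℝ) ≤ α * InnerProductGeometry.angle (p : E3) (q : E3)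

namespace CapSystem

variable {A : ℕ} (S : CapSystem A)

/-- The cap with label `j`. -/
def cap (j : Fin A) : Set (Metric.sphere (0 : E3) 1) :=
  sphericalCap S.α S.α₁ (S.axis j)

/-- The law of the random directions: independent over the vertices, that of `v` being uniform
(with respect to surface area) in the cap that carries the label of `v`. -/
def perturbationLaw {V : Type*} [Fintype V] (lab : V → Fin A) :
    Measure (V → Metric.sphere (0 : E3) 1) :=
  Measure.pi fun v => ProbabilityTheory.cond (volume : Measure E3).toSphere (S.cap (lab v))

/-- Scale `I` by `lam`, then move each vertex `v` by the vector of length `α * lam` in the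
direction `c v`. -/
def perturb {V : Type*} (lam : ℝ) (I : V → E3) (c : V → Metric.sphere (0 : E3) 1) : V → E3 :=
  fun v => lam • I v + ((S.α : ℝ) * lam) • (c v : E3)

end CapSystem

end

/-! After scaling by `lam`, the perturbation spreads each vertex over a piece of a sphere of radius
of order `lam`, so a given square is unlikely to come near a given point. Density is tested only at
points of the integer lattice, with balls of radius 2; every unit ball lies in one of these.

For a lattice point `g`, only squares whose original image lies within `α + 2` of `g / lam` can come
near `g`. Covering by unit balls bounds their number independently of `lam` (`ncard_near_le`,
`near_of_perturb_near`). Such a square comes near `g` with probability `O(lam ^ (-1/2))`: a nearby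
point of one of its triangles has a barycentric coordinate at least `1/3`, and once the other two
vertices are frozen, that vertex must lie in a thin slab, which cuts a zone of small area from its
cap (`exists_slab_of_triangleHit`, `toSphere_sphereZone_le`). The exponent `1/2` is crude but
sufficient.

Squares without common vertices move independently, so seven of them all come near `g` with
probability `O(lam ^ (-7/2))` (`perturbationLaw_badEvent_le`). This bad event depends only on
vertices `v` with `lam • I v` at distance `O(lam)` from `g`, so it interacts with `O(lam ^ 3)`
others. Since `7/2 > 3`, `lovaszLocalLemma` avoids all bad events at once for large `lam`. A unit
ball then meets no seven pairwise disjoint squares; as each square meets boundedly many others, the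
density is bounded in terms of `zv` and `ze` alone. The estimate is uniform over labellings, so a
proper one comes separately from greedy colouring. -/

/-! ### Areas of thin zones of the unit sphere. -/

/-- A subset of the cube `[-1, 1]³` all of whose sections parallel to one axis have length at most
`δ` has volume at most `4 * δ`. -/
lemma volume_le_of_section_le (i : Fin 3) {B : Set (Fin 3 → ℝ)} (hB : MeasurableSet B)
    (hsub : B ⊆ Set.Icc (-1) 1) (δ : ENNReal)
    (h : ∀ y : Fin 2 → ℝ, volume {s : ℝ | i.insertNth (α := fun _ => ℝ) s y ∈ B} ≤ δ) :
    volume B ≤ 4 * δ := by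
  let e := MeasurableEquiv.piFinSuccAbove (fun _ : Fin 3 => ℝ) i
  have mp : MeasurePreserving e.symm volume volume :=
    (volume_preserving_piFinSuccAbove (fun _ : Fin 3 => ℝ) i).symm
  rw [← mp.measure_preimage_equiv B, Measure.volume_eq_prod,
    Measure.prod_apply_symm (e.symm.measurable hB)]
  calc ∫⁻ y, volume ((fun x => (x, y)) ⁻¹' (e.symm ⁻¹' B))
      ≤ ∫⁻ y, (Set.Icc (-1 : Fin 2 → ℝ) 1).indicator (fun _ => δ) y := by
        refine lintegral_mono fun y => ?_
        by_cases hy : y ∈ Set.Icc (-1 : Fin 2 → ℝ) 1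
        · rw [Set.indicator_of_mem hy]
          exact h y
        · rw [Set.indicator_of_notMem hy]
          refine le_of_eq ?_
          convert measure_empty (μ := volume (α := ℝ))
          refine Set.eq_empty_of_forall_notMem fun s hs => hy ?_
          have hs' : i.insertNth (α := fun _ => ℝ) s y ∈ B := hs
          have := hsub hs'
          constructor
          · intro j
            simpa using this.1 (i.succAbove j)
          · intro j
            simpa using this.2 (i.succAbove j)
    _ = 4 * δ := by
        rw [lintegral_indicator measurableSet_Icc, setLIntegral_const, Real.volume_Icc_pi, mul_comm]
        congr 1
        simp only [Pi.one_apply, Pi.neg_apply, Fin.prod_univ_two]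
        rw [← ENNReal.ofReal_mul (by norm_num)]
        norm_num

/-- The window confines `|s|` to an interval of length `√(2 * δ)`, because `√(K + δ) ≤ √(K - δ) +
√(2 * δ)`. When `K < δ`, the square root of the negative number `K - δ` is `0`, and the same
interval works. -/
lemma volume_sq_near_le (K δ : ℝ) (hδ : 0 ≤ δ) :
    volume {s : ℝ | |s ^ 2 - K| ≤ δ} ≤ ENNReal.ofReal (2 * √(2 * δ)) := by
  have hsub : {s : ℝ | |s ^ 2 - K| ≤ δ} ⊆
      Set.Icc (√(K - δ)) (√(K - δ) + √(2 * δ)) ∪ Set.Icc (-(√(K - δ) + √(2 * δ))) (-√(K - δ)) := by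
    intro s hs
    have hs' := abs_le.1 (show |s ^ 2 - K| ≤ δ from hs)
    have h1 : √(K - δ) ≤ |s| := Real.sqrt_le_iff.2 ⟨abs_nonneg s, by rw [sq_abs]; linarith⟩
    have h2 : |s| ≤ √(K - δ) + √(2 * δ) := by
      refine abs_le_of_sq_le_sq ?_ (by positivity)
      have e2 := Real.sq_sqrt (show 0 ≤ 2 * δ by linarith)
      have hp := mul_nonneg (Real.sqrt_nonneg (K - δ)) (Real.sqrt_nonneg (2 * δ))
      rcases le_total 0 (K - δ) with h | h
      · have e1 := Real.sq_sqrt h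
        nlinarith
      · nlinarith [sq_nonneg (√(K - δ))]
    rcases le_total 0 s with h | h
    · rw [abs_of_nonneg h] at h1 h2
      exact Or.inl ⟨h1, h2⟩
    · rw [abs_of_nonpos h] at h1 h2
      exact Or.inr ⟨by linarith, by linarith⟩
  refine (measure_mono hsub).trans ((measure_union_le _ _).trans ?_)
  rw [Real.volume_Icc, Real.volume_Icc, ← ENNReal.ofReal_add (by simp) (by simp)]
  refine ENNReal.ofReal_le_ofReal (le_of_eq (by ring))

/-- The solid cone over a zone of the unit sphere, cleared of square roots. -/
def zoneCone (a ε : ℝ) : Set (Fin 3 → ℝ) :=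
  {y | y 0 ^ 2 + y 1 ^ 2 + y 2 ^ 2 ≤ 1 ∧
    |y 0 ^ 2 - a ^ 2 * (y 0 ^ 2 + y 1 ^ 2 + y 2 ^ 2)| ≤ 3 * ε}

lemma isClosed_zoneCone (a ε : ℝ) : IsClosed (zoneCone a ε) := by
  unfold zoneCone
  rw [Set.ofPred_and]
  exact (isClosed_le (by fun_prop) (by fun_prop)).inter (isClosed_le (by fun_prop) (by fun_prop))

lemma zoneCone_subset (a ε : ℝ) : zoneCone a ε ⊆ Set.Icc (-1) 1 := by
  rintro y ⟨hy, -⟩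
  have : ∀ j, |y j| ≤ 1 := by
    intro j
    refine abs_le_of_sq_le_sq ?_ zero_le_one
    have h0 := sq_nonneg (y 0)
    have h1 := sq_nonneg (y 1)
    have h2 := sq_nonneg (y 2)
    rw [one_pow]
    match j with
    | 0 => linarith
    | 1 => linarith
    | 2 => linarith
  exact ⟨fun j => (abs_le.1 (this j)).1, fun j => (abs_le.1 (this j)).2⟩

/-- In the defining quadratic form, `y 0 ^ 2` has coefficient `1 - a ^ 2` and `y 1 ^ 2` has
coefficient `-a ^ 2`. One of them is at least `1 / 2` in absolute value, and slicing along that axis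
puts the square of the coordinate in a short window. -/
lemma volume_zoneCone_le (a ε : ℝ) (hε : 0 ≤ ε) :
    volume (zoneCone a ε) ≤ 4 * ENNReal.ofReal (2 * √(12 * ε)) := by
  have key : ∀ A B D : ℝ, 1 / 2 ≤ A → |A * D - B| ≤ 3 * ε → |D - B / A| ≤ 6 * ε := by
    intro A B D hA h
    have e : D - B / A = (A * D - B) / A := by field_simp
    rw [e, abs_div, abs_of_pos (by linarith : 0 < A), div_le_iff₀ (by linarith)]
    nlinarith
  have hv : ∀ K : ℝ, volume {s : ℝ | |s ^ 2 - K| ≤ 6 * ε} ≤ ENNReal.ofReal (2 * √(12 * ε)) := by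
    intro K
    have := volume_sq_near_le K (6 * ε) (by linarith)
    rwa [show 2 * (6 * ε) = 12 * ε by ring] at this
  rcases le_total (a ^ 2) (1 / 2) with ha | ha
  · refine volume_le_of_section_le 0 (isClosed_zoneCone a ε).measurableSet (zoneCone_subset a ε) _
      fun y => (measure_mono ?_).trans (hv (a ^ 2 * (y 0 ^ 2 + y 1 ^ 2) / (1 - a ^ 2)))
    rintro s ⟨-, hs⟩
    refine key _ _ _ (by linarith) ?_
    refine le_trans (le_of_eq ?_) hs
    congr 1
    have e1 : (Fin.insertNth (α := fun _ => ℝ) (0 : Fin 3) s y) 1 = y 0 := rfl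
    have e2 : (Fin.insertNth (α := fun _ => ℝ) (0 : Fin 3) s y) 2 = y 1 := rfl
    have e0 : (Fin.insertNth (α := fun _ => ℝ) (0 : Fin 3) s y) 0 = s := rfl
    rw [e0, e1, e2]; ring
  · refine volume_le_of_section_le 1 (isClosed_zoneCone a ε).measurableSet (zoneCone_subset a ε) _
      fun y => (measure_mono ?_).trans
        (hv ((y 0 ^ 2 - a ^ 2 * (y 0 ^ 2 + y 1 ^ 2)) / a ^ 2))
    rintro s ⟨-, hs⟩
    refine key _ _ _ ha ?_
    rw [abs_sub_comm]
    refine le_trans (le_of_eq ?_) hs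
    congr 1
    have e1 : (Fin.insertNth (α := fun _ => ℝ) (1 : Fin 3) s y) 0 = y 0 := rfl
    have e2 : (Fin.insertNth (α := fun _ => ℝ) (1 : Fin 3) s y) 2 = y 1 := rfl
    have e0 : (Fin.insertNth (α := fun _ => ℝ) (1 : Fin 3) s y) 1 = s := rfl
    rw [e0, e1, e2]; ring

/-- The zone of the unit sphere cut out by a slab of half-width `ε` orthogonal to `n`. -/
def sphereZone (n : E3) (a ε : ℝ) : Set (Metric.sphere (0 : E3) 1) :=
  {p | |inner ℝ n (p : E3) - a| ≤ ε}

lemma isClosed_sphereZone (n : E3) (a ε : ℝ) : IsClosed (sphereZone n a ε) :=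
  isClosed_le (by fun_prop) (by fun_prop)

open scoped Pointwise in
/-- The area of a zone of the unit sphere tends to zero with its width. -/
lemma toSphere_sphereZone_le (n : E3) (hn : ‖n‖ = 1) (a ε : ℝ) (hε : 0 ≤ ε) (hε1 : ε ≤ 1) :
    (volume : Measure E3).toSphere (sphereZone n a ε) ≤ ENNReal.ofReal (96 * √ε) := by
  rw [Measure.toSphere_apply' _ (isClosed_sphereZone n a ε).measurableSet]
  -- In an orthonormal basis starting with `n`, the height over the slab's normal is the zeroth
  -- coordinate.
  obtain ⟨b, hb⟩ := Orthonormal.exists_orthonormalBasis_extension_of_card_eq (𝕜 := ℝ) (E := E3)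
    (ι := Fin 3) (by simp) (v := fun _ => n) (s := {0}) (by
      constructor
      · intro i; simpa using hn
      · intro i j hij
        exact absurd (Subsingleton.elim i j) hij)
  have hb0 : b 0 = n := hb 0 rfl
  have mp : MeasurePreserving (fun y : E3 => (b.repr y).ofLp) volume volume :=
    (PiLp.volume_preserving_ofLp (Fin 3)).comp b.measurePreserving_repr
  have hsub : Set.Ioo (0 : ℝ) 1 • (Subtype.val '' sphereZone n a ε) ⊆
      (fun y : E3 => (b.repr y).ofLp) ⁻¹' zoneCone a ε := by
    rintro _ ⟨s, ⟨hs0, hs1⟩, _, ⟨p, hp, rfl⟩, rfl⟩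
    have hp' : |inner ℝ n (p : E3) - a| ≤ ε := hp
    have hpn : ‖(p : E3)‖ = 1 := by simp
    have hin : |inner ℝ n (p : E3)| ≤ 1 := by
      simpa [hn, hpn] using abs_real_inner_le_norm n (p : E3)
    have hsum : (b.repr p).ofLp 0 ^ 2 + (b.repr p).ofLp 1 ^ 2 + (b.repr p).ofLp 2 ^ 2 = 1 := by
      have := EuclideanSpace.norm_sq_eq (b.repr (p : E3))
      rw [LinearIsometryEquiv.norm_map, hpn, Fin.sum_univ_three] at this
      simpa using this.symm
    have h0 : (b.repr p).ofLp 0 = inner ℝ n (p : E3) := by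
      rw [b.repr_apply_apply, hb0]
    have hs2 : s ^ 2 ≤ 1 := by nlinarith
    have hss : ∀ j, (b.repr (s • (p : E3))).ofLp j = s * (b.repr p).ofLp j := by
      intro j; simp
    have hsum' : (b.repr (s • (p : E3))).ofLp 0 ^ 2 + (b.repr (s • (p : E3))).ofLp 1 ^ 2 +
        (b.repr (s • (p : E3))).ofLp 2 ^ 2 = s ^ 2 := by
      rw [hss, hss, hss]; linear_combination s ^ 2 * hsum
    refine ⟨?_, ?_⟩
    · change (b.repr (s • (p : E3))).ofLp 0 ^ 2 + (b.repr (s • (p : E3))).ofLp 1 ^ 2 +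
        (b.repr (s • (p : E3))).ofLp 2 ^ 2 ≤ 1
      rw [hsum']; exact hs2
    · change |(b.repr (s • (p : E3))).ofLp 0 ^ 2 - a ^ 2 * ((b.repr (s • (p : E3))).ofLp 0 ^ 2 +
        (b.repr (s • (p : E3))).ofLp 1 ^ 2 + (b.repr (s • (p : E3))).ofLp 2 ^ 2)| ≤ 3 * ε
      rw [hsum', hss, h0]
      set z := inner ℝ n (p : E3)
      -- The factor 3 in `zoneCone` bounds `|z + a|`: here `|z| ≤ 1`, and `a` is within `ε ≤ 1` of
      -- `z`.
      have e : (s * z) ^ 2 - a ^ 2 * s ^ 2 = s ^ 2 * ((z - a) * (z + a)) := by ring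
      have h2 : |z + a| ≤ 3 := by
        rw [abs_le] at hp' hin ⊢
        constructor <;> linarith
      rw [e, abs_mul, abs_mul, abs_of_nonneg (sq_nonneg s)]
      have : |z - a| * |z + a| ≤ ε * 3 := mul_le_mul hp' h2 (abs_nonneg _) hε
      have h3 : 0 ≤ |z - a| * |z + a| := by positivity
      nlinarith
  have hle := (measure_mono hsub).trans
    ((mp.measure_preimage (isClosed_zoneCone a ε).nullMeasurableSet).le.trans
      (volume_zoneCone_le a ε hε))
  refine (mul_le_mul_right hle _).trans ?_
  -- The constant is `96 = 3 * 4 * 2 * 4`: the dimension from `toSphere`, the area of the square of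
  -- sections, the two signs of the coordinate, and `√12 ≤ 4`.
  have h12 : √(12 * ε) ≤ 4 * √ε := by
    rw [Real.sqrt_le_iff]
    refine ⟨by positivity, ?_⟩
    rw [mul_pow, Real.sq_sqrt hε]; linarith
  have e3 : ((Module.finrank ℝ E3 : ℕ) : ENNReal) = ENNReal.ofReal 3 := by simp
  have e4 : (4 : ENNReal) = ENNReal.ofReal 4 := by simp
  rw [e3, e4, ← ENNReal.ofReal_mul (by norm_num), ← ENNReal.ofReal_mul (by norm_num)]
  exact ENNReal.ofReal_le_ofReal (by linarith)

/-! ### Independence in product spaces and the local lemma. -/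

section ProductSpace

variable {V X : Type*} [MeasurableSpace X]

/-- The events that depend only on the coordinates in `W`. -/
abbrev coordSigma (W : Finset V) : MeasurableSpace (V → X) :=
  MeasurableSpace.comap (fun (c : V → X) (v : W) => c v) inferInstance

lemma coordSigma_le (W : Finset V) : coordSigma (X := X) W ≤ MeasurableSpace.pi := by
  refine Measurable.comap_le ?_
  fun_prop

lemma measurable_eval_coordSigma {W : Finset V} {v : V} (hv : v ∈ W) :
    Measurable[coordSigma W] (fun c : V → X => c v) := by
  have h : Measurable (fun d : W → X => d ⟨v, hv⟩) := measurable_pi_apply _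
  exact h.comp (comap_measurable (fun (c : V → X) (v : W) => c v))

lemma coordSigma_mono {W W' : Finset V} (h : W ⊆ W') :
    coordSigma (X := X) W ≤ coordSigma W' := by
  refine Measurable.comap_le ?_
  exact @measurable_pi_lambda _ _ _ (coordSigma W') _ _
    fun v => measurable_eval_coordSigma (h v.2)

variable [Fintype V] (μ : V → Measure X) [∀ v, IsProbabilityMeasure (μ v)]

lemma pi_inter_eq_mul {W W' : Finset V} (hd : Disjoint W W') {s t : Set (V → X)}
    (hs : MeasurableSet[coordSigma W] s) (ht : MeasurableSet[coordSigma W'] t) :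
    Measure.pi μ (s ∩ t) = Measure.pi μ s * Measure.pi μ t := by
  have h := (ProbabilityTheory.iIndepFun_pi (μ := μ) (X := fun _ x => x)
    fun i => aemeasurable_id).indepFun_finset W W' hd (fun i => measurable_pi_apply i)
  exact (ProbabilityTheory.IndepFun_iff _ _ _).1 h s t hs ht

lemma pi_biInter_eq_prod {ι : Type*} (Q : Finset ι) (W : ι → Finset V)
    (hd : (Q : Set ι).PairwiseDisjoint W) (s : ι → Set (V → X))
    (hs : ∀ i ∈ Q, MeasurableSet[coordSigma (W i)] (s i)) :
    Measure.pi μ (⋂ i ∈ Q, s i) = ∏ i ∈ Q, Measure.pi μ (s i) := by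
  classical
  induction Q using Finset.induction_on with
  | empty => simp
  | insert a Q ha ih =>
    rw [Finset.set_biInter_insert, Finset.prod_insert ha,
      ← ih (hd.subset (by simp)) fun i hi => hs i (Finset.mem_insert_of_mem hi)]
    refine pi_inter_eq_mul (W := W a) (W' := Q.biUnion W) μ ?_ (hs a (by simp)) ?_
    · rw [Finset.disjoint_biUnion_right]
      intro i hi
      exact hd (by simp) (by simp [hi]) (fun h => ha (h ▸ hi))
    · refine Finset.measurableSet_biInter _ fun i hi => ?_
      exact coordSigma_mono (Finset.subset_biUnion_of_mem W hi) _
        (hs i (Finset.mem_insert_of_mem hi))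

/-- Fubini: a bound for the conditional probability given all coordinates other than `v`, uniform in
them, bounds the whole probability. -/
lemma pi_le_of_section_le [DecidableEq V] (v : V) {s : Set (V → X)} (hs : MeasurableSet s)
    (q : ENNReal) (h : ∀ c : V → X, μ v {y | Function.update c v y ∈ s} ≤ q) :
    Measure.pi μ s ≤ q := by
  have := lintegral_le_of_lmarginal_le (μ := μ) {v} (f := s.indicator 1) (g := fun _ => q)
    (measurable_one.indicator hs) measurable_const (by
      intro c
      simp only [lmarginal_singleton]
      rw [lintegral_const, measure_univ, mul_one]
      refine le_trans (le_of_eq ?_) (h c)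
      have hm : MeasurableSet {y | Function.update c v y ∈ s} :=
        (measurable_update c) hs
      rw [← lintegral_indicator_one hm]
      rfl)
  rw [lintegral_indicator_one hs, lintegral_const, measure_univ, mul_one] at this
  exact this

/-- The symmetric Lovász local lemma for events that depend on finite sets of independent
variables. -/
theorem lovaszLocalLemma {ι : Type*} (W : ι → Finset V) (B : ι → Set (V → X))
    (hB : ∀ i, MeasurableSet[coordSigma (W i)] (B i)) (p : ℝ) (d : ℕ)
    (hp : ∀ i, (Measure.pi μ).real (B i) ≤ p) (N : ι → Finset ι)
    (hN : ∀ i j, ¬ Disjoint (W i) (W j) → j ∈ N i) (hd : ∀ i, (N i).card ≤ d)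
    (hd1 : 1 ≤ d) (hpd : 4 * d * p ≤ 1) (S : Finset ι) :
    0 < (Measure.pi μ).real (⋂ i ∈ S, (B i)ᶜ) := by
  classical
  set P := Measure.pi μ with hP
  let G : Finset ι → Set (V → X) := fun S => ⋂ i ∈ S, (B i)ᶜ
  have hBm : ∀ i, MeasurableSet (B i) := fun i => coordSigma_le _ _ (hB i)
  have hGm : ∀ S, MeasurableSet (G S) := fun S =>
    Finset.measurableSet_biInter _ fun i _ => (hBm i).compl
  have hGins : ∀ i S, G (insert i S) = G S \ B i := by
    intro i S
    simp only [G, Finset.set_biInter_insert]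
    rw [Set.inter_comm]; rfl
  have hd0 : (0 : ℝ) < d := by exact_mod_cast hd1
  have step : ∀ i S, P.real (G (insert i S)) = P.real (G S) - P.real (G S ∩ B i) := by
    intro i S
    have := measureReal_inter_add_sdiff (μ := P) (s := G S) (hBm i)
    rw [hGins]; linarith
  -- The second clause says that, given that no event of `S` occurs, each event has conditional
  -- probability at most `1 / (2 * d)`. Positivity is carried along in the same induction.
  have main : ∀ n, ∀ S : Finset ι, S.card = n →
      0 < P.real (G S) ∧ ∀ i, P.real (G S ∩ B i) ≤ 1 / (2 * d) * P.real (G S) := by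
    intro n
    induction n using Nat.strong_induction_on with
    | _ n IH =>
    intro S hS
    have hpos : 0 < P.real (G S) := by
      rcases S.eq_empty_or_nonempty with rfl | ⟨j, hj⟩
      · simp [G]
      · have hc : (S.erase j).card < n := hS ▸ Finset.card_erase_lt_of_mem hj
        obtain ⟨h1, h2⟩ := IH _ hc _ rfl
        have h3 := step j (S.erase j)
        rw [Finset.insert_erase hj] at h3
        have h4 := h2 j
        have : 1 / (2 * (d : ℝ)) ≤ 1 / 2 := by
          apply one_div_le_one_div_of_le <;> norm_num
          exact hd1
        nlinarith
    refine ⟨hpos, fun i => ?_⟩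
    by_cases hdis : ∀ j ∈ S, j ∉ N i
    · have : P (B i ∩ G S) = P (B i) * P (G S) := by
        refine pi_inter_eq_mul (W := W i) (W' := S.biUnion W) μ ?_ (hB i) ?_
        · rw [Finset.disjoint_biUnion_right]
          intro j hj
          by_contra hcon
          exact hdis j hj (hN i j hcon)
        · refine Finset.measurableSet_biInter _ fun j hj => ?_
          exact coordSigma_mono (Finset.subset_biUnion_of_mem W hj) _ (hB j).compl
      have hr : P.real (G S ∩ B i) = P.real (B i) * P.real (G S) := by
        rw [Set.inter_comm, Measure.real, this, ENNReal.toReal_mul]; rfl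
      rw [hr]
      refine mul_le_mul_of_nonneg_right ?_ hpos.le
      rw [le_div_iff₀ (by positivity)]
      have := hp i
      have := measureReal_nonneg (μ := P) (s := B i)
      nlinarith
    · push Not at hdis
      obtain ⟨j₀, hj₀, hj₀'⟩ := hdis
      -- Dropping the neighbours of `i` leaves a strictly smaller family that is independent of `B
      -- i`.
      let S₂ := S.filter (· ∉ N i)
      have hS₂ : S₂.card < n := by
        rw [← hS]
        refine Finset.card_lt_card ⟨Finset.filter_subset _ _, fun h => ?_⟩
        exact (Finset.mem_filter.1 (h hj₀)).2 hj₀'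
      obtain ⟨h1, h2⟩ := IH _ hS₂ _ rfl
      -- Restoring the neighbours one at a time costs at most `1 / (2 * d)` of `P.real (G S₂)` each.
      -- There are at most `d` of them, so at least half remains.
      have key : ∀ U : Finset ι, U ⊆ S.filter (· ∈ N i) →
          P.real (G S₂) * (1 - U.card / (2 * d)) ≤ P.real (G (U ∪ S₂)) := by
        intro U
        induction U using Finset.induction_on with
        | empty => simp
        | insert a U ha ih =>
          intro hU
          have h3 := ih ((Finset.subset_insert a U).trans hU)
          rw [Finset.insert_union, step a (U ∪ S₂), Finset.card_insert_of_notMem ha]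
          have h5 : P.real (G (U ∪ S₂) ∩ B a) ≤ P.real (G S₂ ∩ B a) := by
            refine measureReal_mono (Set.inter_subset_inter_left _ ?_)
            exact Set.biInter_subset_biInter_left (fun x hx => by simp_all)
          have h6 := h2 a
          push_cast
          have : P.real (G S₂) * (1 - (U.card + 1) / (2 * d)) =
              P.real (G S₂) * (1 - U.card / (2 * d)) - 1 / (2 * d) * P.real (G S₂) := by
            field_simp
            ring
          linarith
      have hU := key _ (Finset.Subset.refl _)
      rw [Finset.filter_union_filter_not_eq] at hU
      have hcard : ((S.filter (· ∈ N i)).card : ℝ) ≤ d := by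
        have : (S.filter (· ∈ N i)).card ≤ d :=
          (Finset.card_le_card fun x hx => (Finset.mem_filter.1 hx).2).trans (hd i)
        exact_mod_cast this
      have hhalf : P.real (G S₂) * (1 / 2) ≤ P.real (G S) := by
        refine le_trans ?_ hU
        refine mul_le_mul_of_nonneg_left ?_ h1.le
        have : ((S.filter (· ∈ N i)).card : ℝ) / (2 * d) ≤ 1 / 2 := by
          rw [div_le_div_iff₀ (by positivity) (by norm_num)]; linarith
        linarith
      have hind : P (B i ∩ G S₂) = P (B i) * P (G S₂) := by
        refine pi_inter_eq_mul (W := W i) (W' := S₂.biUnion W) μ ?_ (hB i) ?_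
        · rw [Finset.disjoint_biUnion_right]
          intro j hj
          by_contra hcon
          exact (Finset.mem_filter.1 hj).2 (hN i j hcon)
        · refine Finset.measurableSet_biInter _ fun j hj => ?_
          exact coordSigma_mono (Finset.subset_biUnion_of_mem W hj) _ (hB j).compl
      have hr : P.real (G S₂ ∩ B i) = P.real (B i) * P.real (G S₂) := by
        rw [Set.inter_comm, Measure.real, hind, ENNReal.toReal_mul]; rfl
      have hle : P.real (G S ∩ B i) ≤ P.real (G S₂ ∩ B i) := by
        refine measureReal_mono (Set.inter_subset_inter_left _ ?_)
        exact Set.biInter_subset_biInter_left (fun x hx => (Finset.mem_filter.1 hx).1)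
      have hpi := hp i
      have h7 : P.real (B i) ≤ 1 / (4 * d) := by
        rw [le_div_iff₀ (by positivity)]
        nlinarith
      have h8 : P.real (B i) * P.real (G S₂) ≤ 1 / (4 * d) * (2 * P.real (G S)) :=
        mul_le_mul h7 (by linarith) h1.le (by positivity)
      have h9 : 1 / (4 * (d : ℝ)) * (2 * P.real (G S)) = 1 / (2 * d) * P.real (G S) := by
        field_simp
        norm_num
      linarith
  exact (main _ S rfl).1

end ProductSpace

/-! ### Triangles near a point, and slabs. -/

/-- The triangles that come within distance `r` of `x` at a point whose barycentric coordinate with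
respect to the vertex `i` is at least `1 / 3`. -/
def triangleHit (i : Fin 3) (x : E3) (r : ℝ) : Set (Fin 3 → E3) :=
  {d | ∃ w ∈ stdSimplex ℝ (Fin 3), 1 / 3 ≤ w i ∧ dist (∑ j, w j • d j) x ≤ r}

/-- The set is the projection of a closed set along the compact simplex of barycentric coordinates.
-/
lemma isClosed_triangleHit (i : Fin 3) (x : E3) (r : ℝ) : IsClosed (triangleHit i x r) := by
  let K : Set (stdSimplex ℝ (Fin 3) × (Fin 3 → E3)) :=
    {z | 1 / 3 ≤ z.1.1 i} ∩ {z | dist (∑ j, z.1.1 j • z.2 j) x ≤ r}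
  have hK : IsClosed K := by
    have h (j : Fin 3) : Continuous fun z : stdSimplex ℝ (Fin 3) × (Fin 3 → E3) => z.1.1 j :=
      (continuous_apply j).comp (continuous_subtype_val.comp continuous_fst)
    refine (isClosed_le continuous_const (h i)).inter (isClosed_le ?_ continuous_const)
    refine (continuous_finsetSum _ fun j _ => (h j).smul ?_).dist continuous_const
    exact (continuous_apply j).comp continuous_snd
  have : CompactSpace (stdSimplex ℝ (Fin 3)) :=
    isCompact_iff_compactSpace.1 (isCompact_stdSimplex ℝ (Fin 3))
  convert isClosedMap_snd_of_compactSpace _ hK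
  ext d
  constructor
  · rintro ⟨w, hw, h1, h2⟩
    exact ⟨(⟨w, hw⟩, d), ⟨h1, h2⟩, rfl⟩
  · rintro ⟨⟨w, d⟩, ⟨h1, h2⟩, rfl⟩
    exact ⟨w.1, w.2, h1, h2⟩

lemma exists_triangleHit_of_convexHull (d : Fin 3 → E3) (x : E3) (r : ℝ)
    (h : (convexHull ℝ (Set.range d) ∩ Metric.closedBall x r).Nonempty) :
    ∃ i, d ∈ triangleHit i x r := by
  obtain ⟨p, hp, hpx⟩ := h
  have hsub : convexHull ℝ (Set.range d) ⊆
      (fun w : Fin 3 → ℝ => ∑ j, w j • d j) '' stdSimplex ℝ (Fin 3) := by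
    refine convexHull_min ?_ ?_
    · rintro _ ⟨j, rfl⟩
      exact ⟨Pi.single j 1, single_mem_stdSimplex ℝ j, by simp [Pi.single_apply]⟩
    · refine (convex_stdSimplex ℝ (Fin 3)).is_linear_image ⟨fun a b => ?_, fun a b => ?_⟩
      · simp [add_smul, Finset.sum_add_distrib]
      · simp [mul_smul, Finset.smul_sum]
  obtain ⟨w, hw, rfl⟩ := hsub hp
  have hsum := hw.2
  rw [Fin.sum_univ_three] at hsum
  have : ∃ i, 1 / 3 ≤ w i := by
    by_contra hcon
    push Not at hcon
    linarith [hcon 0, hcon 1, hcon 2]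
  obtain ⟨i, hi⟩ := this
  exact ⟨i, w, hw, hi, hpx⟩

lemma exists_unit_orthogonal (u v : E3) :
    ∃ n : E3, ‖n‖ = 1 ∧ inner ℝ n u = 0 ∧ inner ℝ n v = 0 := by
  have hlt : Module.finrank ℝ (Submodule.span ℝ {u, v}) ≤ 2 := by
    classical
    have := finrank_span_finset_le_card (R := ℝ) ({u, v} : Finset E3)
    have h2 : ({u, v} : Finset E3).card ≤ 2 := Finset.card_le_two
    rw [Set.finrank, Finset.coe_pair] at this
    exact this.trans h2
  have hadd := (Submodule.span ℝ {u, v}).finrank_add_finrank_orthogonal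
  have h3 : Module.finrank ℝ E3 = 3 := by simp
  have hne : (Submodule.span ℝ {u, v})ᗮ ≠ ⊥ := by
    intro h0
    rw [h0, finrank_bot] at hadd
    omega
  obtain ⟨n, hn, hn0⟩ := Submodule.exists_mem_ne_zero_of_ne_bot hne
  have hmem (z : E3) (hz : z ∈ ({u, v} : Set E3)) : inner ℝ n z = 0 :=
    (Submodule.mem_orthogonal' _ n).1 hn z (Submodule.subset_span hz)
  refine ⟨‖n‖⁻¹ • n, ?_, ?_, ?_⟩
  · rw [norm_smul, norm_inv, norm_norm, inv_mul_cancel₀ (norm_ne_zero_iff.2 hn0)]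
  · rw [real_inner_smul_left, hmem u (by simp), mul_zero]
  · rw [real_inner_smul_left, hmem v (by simp), mul_zero]

/-- If two vertices of a triangle are fixed, then the third one has to lie in a slab for the
triangle to come near `x` away from the opposite side. -/
lemma exists_slab_of_triangleHit (i : Fin 3) (x : E3) (r : ℝ) (d : Fin 3 → E3) :
    ∃ (n : E3) (b : ℝ), ‖n‖ = 1 ∧
      ∀ y, Function.update d i y ∈ triangleHit i x r → |inner ℝ n y - b| ≤ 3 * r := by
  -- The vector `n` is normal to a plane through `x` and the two frozen vertices.
  obtain ⟨n, hn, h1, h2⟩ := exists_unit_orthogonal (d (i + 1) - x) (d (i + 2) - x)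
  refine ⟨n, inner ℝ n x, hn, ?_⟩
  rintro y ⟨w, hw, hwi, hd⟩
  have hsum := hw.2
  have huniv : ∀ f : Fin 3 → ℝ, ∑ j, f j = f i + f (i + 1) + f (i + 2) := by
    intro f
    rw [Fin.sum_univ_three]
    match i with
    | 0 => rfl
    | 1 => change _ = f 1 + f 2 + f 0; ring
    | 2 => change _ = f 2 + f 0 + f 1; ring
  have hne1 : i + 1 ≠ i := by clear * -; decide +revert
  have hne2 : i + 2 ≠ i := by clear * -; decide +revert
  rw [inner_sub_right, sub_eq_zero] at h1 h2
  -- Pairing with `n` removes the frozen vertices. What remains is `w i` times the height of the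
  -- free vertex, and `w i ≥ 1 / 3` gives the half-width `3 * r`.
  have e : inner ℝ n (∑ j, w j • Function.update d i y j - x) =
      w i * (inner ℝ n y - inner ℝ n x) := by
    rw [inner_sub_right, inner_sum, huniv]
    rw [huniv] at hsum
    simp only [real_inner_smul_right, Function.update_self, Function.update_of_ne hne1,
      Function.update_of_ne hne2, h1, h2]
    linear_combination (inner ℝ n x) * hsum
  have hle : |w i * (inner ℝ n y - inner ℝ n x)| ≤ r := by
    rw [← e]
    refine (abs_real_inner_le_norm _ _).trans ?_
    rw [hn, one_mul, ← dist_eq_norm]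
    exact hd
  rw [abs_mul, abs_of_nonneg (by linarith)] at hle
  have := abs_nonneg (inner ℝ n y - inner ℝ n x)
  nlinarith

/-- The vertices of the two triangles into which a square is cut. -/
def halfSquare : Fin 2 → Fin 3 → Fin 4 := ![![0, 1, 2], ![0, 2, 3]]

lemma halfSquare_injective (h : Fin 2) : Function.Injective (halfSquare h) := by
  revert h; decide

/-! ### Lattice points and coverings by unit balls. -/

/-- The point of the integer lattice with coordinates `g`. -/
def latticePoint (g : Fin 3 → ℤ) : E3 := WithLp.toLp 2 fun i => (g i : ℝ)

lemma exists_latticePoint_near (x : E3) : ∃ g, dist x (latticePoint g) ≤ 1 := by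
  refine ⟨fun i => round (x i), ?_⟩
  rw [EuclideanSpace.dist_eq, Real.sqrt_le_left zero_le_one, one_pow, Fin.sum_univ_three]
  have h (i : Fin 3) : dist (x i) (latticePoint (fun i => round (x i)) i) ^ 2 ≤ 1 / 4 := by
    have h1 : dist (x i) (latticePoint (fun i => round (x i)) i) ≤ 1 / 2 := abs_sub_round (x i)
    nlinarith [dist_nonneg (x := x i) (y := latticePoint (fun i => round (x i)) i)]
  linarith [h 0, h 1, h 2]

/-- The lattice points in a cube. -/
noncomputable def latticeCube (y : E3) (ρ : ℝ) : Finset (Fin 3 → ℤ) :=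
  Fintype.piFinset fun i => Finset.Icc ⌈y i - ρ⌉ ⌊y i + ρ⌋

lemma mem_latticeCube {y : E3} {ρ : ℝ} {g : Fin 3 → ℤ} (h : dist (latticePoint g) y ≤ ρ) :
    g ∈ latticeCube y ρ := by
  refine Fintype.mem_piFinset.2 fun i => Finset.mem_Icc.2 ?_
  have h1 : |(g i : ℝ) - y i| ≤ ρ := by
    have := PiLp.norm_apply_le (latticePoint g - y) i
    rw [dist_eq_norm] at h
    exact this.trans h
  rw [abs_le] at h1
  exact ⟨Int.ceil_le.2 (by linarith), Int.le_floor.2 (by linarith)⟩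

lemma card_latticeCube_le (y : E3) (ρ : ℝ) (hρ : 0 ≤ ρ) :
    (latticeCube y ρ).card ≤ (⌊2 * ρ⌋₊ + 1) ^ 3 := by
  rw [latticeCube, Fintype.card_piFinset]
  refine (Finset.prod_le_pow_card _ _ (⌊2 * ρ⌋₊ + 1) fun i _ => ?_).trans (by simp)
  rw [Int.card_Icc, Int.toNat_le]
  have h1 : ⌊y i + ρ⌋ - ⌈y i - ρ⌉ ≤ ⌊2 * ρ⌋ := by
    rw [Int.le_floor]
    push_cast
    linarith [Int.floor_le (y i + ρ), Int.le_ceil (y i - ρ)]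
  have h2 : ((⌊2 * ρ⌋₊ : ℕ) : ℤ) = ⌊2 * ρ⌋ := Int.natCast_floor_eq_floor (by linarith)
  push_cast
  rw [h2]
  linarith

lemma exists_finset_cover (ρ : ℝ) :
    ∃ Z : Finset E3, Metric.closedBall (0 : E3) ρ ⊆ ⋃ z ∈ Z, Metric.closedBall z 1 := by
  obtain ⟨Z, -, hZ, h⟩ := (isCompact_closedBall (0 : E3) ρ).finite_cover_balls one_pos
  refine ⟨hZ.toFinset, h.trans ?_⟩
  simp only [Set.Finite.mem_toFinset]
  exact Set.iUnion₂_mono fun z _ => Metric.ball_subset_closedBall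

/-! ### Squares of the original complex near a ball. -/

namespace SquareComplex

variable {V F : Type*} (T : SquareComplex V F)

lemma cellImage_eq (I : V → E3) (f : F) :
    T.cellImage I f =
      ⋃ h, convexHull ℝ (Set.range fun j => I (T.corner f (halfSquare h j))) := by
  have h3 (u : Fin 3 → E3) : Set.range u = {u 0, u 1, u 2} := by
    ext z
    simp [Fin.exists_fin_succ, eq_comm]
  ext z
  simp [cellImage, halfSquare, h3, Fin.exists_fin_two]

lemma dist_corner_le {I : V → E3} {t : ℝ} (hI : T.IsEmbedding I t 1) (f : F) (i j : Fin 4) :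
    dist (I (T.corner f i)) (I (T.corner f j)) ≤ 2 := by
  have h1 (i : Fin 4) : dist (I (T.corner f i)) (I (T.corner f (i + 1))) ≤ 1 :=
    hI.locality _ _ (T.corner_adj f i)
  have h2 (i : Fin 4) : dist (I (T.corner f i)) (I (T.corner f (i + 2))) ≤ 2 := by
    have := h1 (i + 1)
    rw [add_assoc, show (1 + 1 : Fin 4) = 2 from rfl] at this
    linarith [dist_triangle (I (T.corner f i)) (I (T.corner f (i + 1))) (I (T.corner f (i + 2))),
      h1 i]
  have h3 (i : Fin 4) : dist (I (T.corner f i)) (I (T.corner f (i + 3))) ≤ 1 := by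
    have := h1 (i + 3)
    rw [add_assoc, show (3 + 1 : Fin 4) = 0 from rfl, add_zero, dist_comm] at this
    exact this
  have hj : j = i ∨ j = i + 1 ∨ j = i + 2 ∨ j = i + 3 := by revert i j; decide
  rcases hj with rfl | rfl | rfl | rfl
  · simp
  · linarith [h1 i]
  · exact h2 i
  · linarith [h3 i]

lemma dist_corner_le_of_near {I : V → E3} {t : ℝ} (hI : T.IsEmbedding I t 1) {f : F} {y : E3}
    {ρ : ℝ} (h : (T.cellImage I f ∩ Metric.closedBall y ρ).Nonempty) (i : Fin 4) :
    dist (I (T.corner f i)) y ≤ ρ + 2 := by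
  obtain ⟨p, hp, hpy⟩ := h
  rw [cellImage_eq, Set.mem_iUnion] at hp
  obtain ⟨k, hk⟩ := hp
  have : convexHull ℝ (Set.range fun j => I (T.corner f (halfSquare k j))) ⊆
      Metric.closedBall (I (T.corner f i)) 2 := by
    refine convexHull_min ?_ (convex_closedBall _ _)
    rintro _ ⟨j, rfl⟩
    exact T.dist_corner_le hI f _ _
  have h1 : dist p (I (T.corner f i)) ≤ 2 := this hk
  have h2 : dist p y ≤ ρ := hpy
  linarith [dist_triangle_left (I (T.corner f i)) y p]

/-- The density hypothesis speaks of unit balls only; covering a larger ball by translates of them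
costs the factor `Z.card`, which depends on `ρ` alone. -/
lemma ncard_near_le [Finite F] {I : V → E3} {t : ℝ} (hI : T.IsEmbedding I t 1) {ρ : ℝ}
    {Z : Finset E3} (hZ : Metric.closedBall (0 : E3) ρ ⊆ ⋃ z ∈ Z, Metric.closedBall z 1) (y : E3) :
    ({f | (T.cellImage I f ∩ Metric.closedBall y ρ).Nonempty}.ncard : ℝ) ≤ Z.card * t := by
  have hsub : {f | (T.cellImage I f ∩ Metric.closedBall y ρ).Nonempty} ⊆
      ⋃ z ∈ Z, {f | (T.cellImage I f ∩ Metric.closedBall (y + z) 1).Nonempty} := by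
    rintro f ⟨p, hp, hpy⟩
    have : p - y ∈ Metric.closedBall (0 : E3) ρ := by
      simpa [dist_eq_norm] using hpy
    obtain ⟨z, hz, hpz⟩ := Set.mem_iUnion₂.1 (hZ this)
    refine Set.mem_iUnion₂.2 ⟨z, hz, p, hp, ?_⟩
    rw [Metric.mem_closedBall, dist_eq_norm] at hpz ⊢
    rwa [← sub_sub]
  have h1 := (Set.ncard_le_ncard hsub (Set.toFinite _)).trans (Finset.set_ncard_biUnion_le Z _)
  calc ({f | (T.cellImage I f ∩ Metric.closedBall y ρ).Nonempty}.ncard : ℝ)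
      ≤ ((∑ z ∈ Z, {f | (T.cellImage I f ∩ Metric.closedBall (y + z) 1).Nonempty}.ncard : ℕ) : ℝ) :=
        by exact_mod_cast h1
    _ ≤ ∑ z ∈ Z, t := by
        push_cast
        exact Finset.sum_le_sum fun z _ => hI.density (y + z)
    _ = Z.card * t := by simp

end SquareComplex

/-! ### Deterministic effects of the perturbation. -/

namespace CapSystem

variable {A : ℕ} (S : CapSystem A) {V F : Type*} (T : SquareComplex V F)

lemma alpha_pos : 0 < (S.α : ℝ) := by
  have := S.lt_radius
  exact_mod_cast (by omega : 0 < S.α)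

/-- A square whose perturbed image meets a ball was near the rescaled ball before. -/
lemma near_of_perturb_near {lam : ℝ} (hlam : 1 ≤ lam) (I : V → E3)
    (c : V → Metric.sphere (0 : E3) 1) (f : F) (x : E3) (r : ℝ)
    (h : (T.cellImage (S.perturb lam I c) f ∩ Metric.closedBall x r).Nonempty) :
    (T.cellImage I f ∩ Metric.closedBall (lam⁻¹ • x) (S.α + r)).Nonempty := by
  have hlam0 : 0 < lam := by linarith
  obtain ⟨p, hp, hpx⟩ := h
  rw [T.cellImage_eq, Set.mem_iUnion] at hp
  obtain ⟨k, hk⟩ := hp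
  obtain ⟨i, w, hw, -, hd⟩ := exists_triangleHit_of_convexHull _ x r ⟨p, hk, hpx⟩
  -- The witness is the point of the unperturbed triangle with the same barycentric coordinates.
  -- After dividing by `lam` it has moved by at most `α`, since a convex combination of unit vectors
  -- has norm at most 1.
  refine ⟨∑ j, w j • I (T.corner f (halfSquare k j)), ?_, ?_⟩
  · rw [T.cellImage_eq, Set.mem_iUnion]
    exact ⟨k, (convex_convexHull ℝ _).sum_mem (fun j _ => hw.1 j) hw.2
      fun j _ => subset_convexHull ℝ _ ⟨j, rfl⟩⟩
  · set u := ∑ j, w j • I (T.corner f (halfSquare k j)) with hu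
    set e := ∑ j, w j • (c (T.corner f (halfSquare k j)) : E3) with he
    have hsplit : ∑ j, w j • S.perturb lam I c (T.corner f (halfSquare k j)) =
        lam • u + ((S.α : ℝ) * lam) • e := by
      rw [hu, he, Finset.smul_sum, Finset.smul_sum, ← Finset.sum_add_distrib]
      refine Finset.sum_congr rfl fun j _ => ?_
      rw [perturb, smul_add, smul_comm (w j) lam, smul_comm (w j) ((S.α : ℝ) * lam)]
    have hen : ‖e‖ ≤ 1 := by
      refine (norm_sum_le _ _).trans ?_
      refine le_trans (Finset.sum_le_sum fun j _ => ?_) hw.2.le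
      rw [norm_smul, Real.norm_of_nonneg (hw.1 j)]
      simp
    rw [hsplit, dist_eq_norm] at hd
    rw [Metric.mem_closedBall, dist_eq_norm]
    have hα := S.alpha_pos
    have e1 : u - lam⁻¹ • x = lam⁻¹ • (lam • u + ((S.α : ℝ) * lam) • e - x) - (S.α : ℝ) • e := by
      rw [smul_sub, smul_add, smul_smul, smul_smul, inv_mul_cancel₀ hlam0.ne', one_smul,
        show lam⁻¹ * ((S.α : ℝ) * lam) = S.α by field_simp]
      abel
    rw [e1]
    refine (norm_sub_le _ _).trans ?_
    rw [norm_smul, norm_smul, Real.norm_of_nonneg (inv_nonneg.2 hlam0.le),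
      Real.norm_of_nonneg hα.le]
    have h1 : lam⁻¹ * ‖lam • u + ((S.α : ℝ) * lam) • e - x‖ ≤ 1 * r :=
      mul_le_mul (inv_le_one_of_one_le₀ hlam) hd (norm_nonneg _) zero_le_one
    nlinarith

lemma perturb_locality {lam t : ℝ} (hlam : 0 ≤ lam) {I : V → E3} (hI : T.IsEmbedding I t 1)
    (c : V → Metric.sphere (0 : E3) 1) (u w : V) (h : T.graph.Adj u w) :
    dist (S.perturb lam I c u) (S.perturb lam I c w) ≤ (2 * (S.α : ℝ) + 1) * lam := by
  have hα := S.alpha_pos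
  have h1 := hI.locality u w h
  rw [dist_eq_norm] at h1 ⊢
  have e : S.perturb lam I c u - S.perturb lam I c w =
      lam • (I u - I w) + ((S.α : ℝ) * lam) • ((c u : E3) - (c w : E3)) := by
    simp only [perturb, smul_sub]; abel
  rw [e]
  refine (norm_add_le _ _).trans ?_
  rw [norm_smul, norm_smul, Real.norm_of_nonneg hlam, Real.norm_of_nonneg (by positivity)]
  have h2 : ‖(c u : E3) - (c w : E3)‖ ≤ 2 := by
    refine (norm_sub_le _ _).trans ?_
    simp only [norm_eq_of_mem_sphere]
    norm_num
  have h3 : lam * ‖I u - I w‖ ≤ lam * 1 := mul_le_mul_of_nonneg_left h1 hlam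
  have h4 : (S.α : ℝ) * lam * ‖(c u : E3) - (c w : E3)‖ ≤ S.α * lam * 2 :=
    mul_le_mul_of_nonneg_left h2 (by positivity)
  linarith

end CapSystem

/-! ### Existence of cap systems. -/

lemma infinite_sphere : Infinite (Metric.sphere (0 : E3) 1) := by
  rw [Set.infinite_coe_iff]
  refine (isPreconnected_sphere ?_ 0 1).infinite_of_nontrivial ?_
  · rw [← Module.finrank_eq_rank, finrank_euclideanSpace_fin]
    norm_num
  · refine ⟨EuclideanSpace.single 0 1, by simp, -EuclideanSpace.single 0 1, by simp, fun h => ?_⟩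
    have h0 := congrArg (fun z : E3 => z 0) h
    simp at h0
    linarith

/-- There are cap systems with any number of labels. -/
lemma exists_capSystem (A : ℕ) : Nonempty (CapSystem A) := by
  have := infinite_sphere
  let axis : Fin A ↪ Metric.sphere (0 : E3) 1 :=
    Fin.valEmbedding.trans (Infinite.natEmbedding _)
  have hpos (i j : Fin A) (hij : i ≠ j) :
      0 < InnerProductGeometry.angle (axis i : E3) (axis j : E3) := by
    refine lt_of_le_of_ne (InnerProductGeometry.angle_nonneg _ _) fun h => hij ?_
    obtain ⟨-, r, hr, hrr⟩ := InnerProductGeometry.angle_eq_zero_iff.1 h.symm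
    have hn := congrArg norm hrr
    rw [norm_smul, norm_eq_of_mem_sphere, norm_eq_of_mem_sphere, mul_one,
      Real.norm_of_nonneg hr.le] at hn
    rw [← hn, one_smul] at hrr
    exact axis.injective (Subtype.ext hrr.symm)
  obtain ⟨δ, hδ, hδ0⟩ : ∃ δ : ℝ, (∀ i j, i ≠ j →
      δ ≤ InnerProductGeometry.angle (axis i : E3) (axis j : E3)) ∧ 0 < δ := by
    have h1 : ∀ᶠ δ : ℝ in nhdsWithin 0 (Set.Ioi 0), ∀ i j, i ≠ j →
        δ ≤ InnerProductGeometry.angle (axis i : E3) (axis j : E3) := by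
      refine Filter.eventually_all.2 fun i => Filter.eventually_all.2 fun j => ?_
      by_cases hij : i = j
      · simp [hij]
      · filter_upwards [Ioo_mem_nhdsGT (hpos i j hij)] with δ h _ using h.2.le
    exact (h1.and self_mem_nhdsWithin).exists
  obtain ⟨M, hM⟩ := exists_nat_gt (max 3 (3 / δ))
  have hM3 : 3 < M := by exact_mod_cast (le_max_left _ _).trans_lt hM
  have hMδ : 3 ≤ M * δ := by
    have := (le_max_right _ _).trans hM.le
    rwa [div_le_iff₀ hδ0] at this
  have hM0 : (0 : ℝ) < M := by positivity
  have hcos : 0 < M * (1 - Real.cos (1 / M)) := by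
    have h2 : (1 : ℝ) / M ≤ 1 := by
      rw [div_le_one hM0]
      exact_mod_cast (by omega : 1 ≤ M)
    have h1 := Real.cos_lt_cos_of_nonneg_of_le_pi (x := 0) (y := 1 / (M : ℝ)) le_rfl
      (by linarith [Real.pi_gt_three]) (by positivity)
    rw [Real.cos_zero] at h1
    have : 0 < 1 - Real.cos (1 / M) := by linarith
    positivity
  obtain ⟨m, hm⟩ := exists_nat_gt (max 1 (1 / (M * (1 - Real.cos (1 / M)))))
  have hm1 : 1 < m := by exact_mod_cast (le_max_left _ _).trans_lt hm
  have hm2 : 1 < m * (M * (1 - Real.cos (1 / M))) := by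
    have := (le_max_right _ _).trans_lt hm
    rwa [div_lt_iff₀ hcos] at this
  have hm0 : (0 : ℝ) < m := by positivity
  -- With `α = M * m` and `α₂ = m`, the ratio `α₂ / α = 1 / M` is fixed, so a large `m` makes the
  -- width parameter positive. Each point of a cap is within arc `1 / 2` of its axis and the axes
  -- are at arc distance at least `3 * m`, leaving `3 * m - 1 ≥ 2 * m`.
  refine ⟨⟨M * m, 1, m, one_pos, by omega, by nlinarith, ?_, axis, ?_⟩⟩
  · push_cast
    rw [show (m : ℝ) / (M * m) = 1 / M by field_simp]
    linarith
  · intro i j hij p hp q hq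
    have hp' : ((M * m : ℕ) : ℝ) * InnerProductGeometry.angle (p : E3) (axis i : E3) ≤
      (1 : ℕ) / 2 := hp
    have hq' : ((M * m : ℕ) : ℝ) * InnerProductGeometry.angle (q : E3) (axis j : E3) ≤
      (1 : ℕ) / 2 := hq
    have h1 := InnerProductGeometry.angle_le_angle_add_angle (axis i : E3) (p : E3) (axis j : E3)
    have h2 := InnerProductGeometry.angle_le_angle_add_angle (p : E3) (q : E3) (axis j : E3)
    rw [InnerProductGeometry.angle_comm (axis i : E3) (p : E3)] at h1
    have h3 := hδ i j hij
    have hMm : (0 : ℝ) ≤ ((M * m : ℕ) : ℝ) := by positivity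
    have h4 := mul_le_mul_of_nonneg_left (h3.trans (h1.trans (add_le_add_right h2 _))) hMm
    have h5 : (3 : ℝ) * m ≤ ((M * m : ℕ) : ℝ) * δ := by
      push_cast
      nlinarith
    have h6 : (1 : ℝ) < m := by exact_mod_cast hm1
    rw [mul_add, mul_add] at h4
    push_cast at *
    linarith

/-! ### The uniform law on a cap. -/

namespace CapSystem

variable {A : ℕ} (S : CapSystem A)

lemma continuous_angle_sphere (a : Metric.sphere (0 : E3) 1) :
    Continuous fun p : Metric.sphere (0 : E3) 1 =>
      InnerProductGeometry.angle (p : E3) (a : E3) := by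
  simp only [InnerProductGeometry.angle, norm_eq_of_mem_sphere]
  fun_prop

lemma isClosed_cap (j : Fin A) : IsClosed (S.cap j) :=
  isClosed_le (continuous_const.mul (continuous_angle_sphere _)) continuous_const

lemma toSphere_cap_pos (j : Fin A) : 0 < (volume : Measure E3).toSphere (S.cap j) := by
  have hopen : IsOpen {p : Metric.sphere (0 : E3) 1 |
      (S.α : ℝ) * InnerProductGeometry.angle (p : E3) (S.axis j : E3) < (S.α₁ : ℝ) / 2} :=
    isOpen_lt (continuous_const.mul (continuous_angle_sphere _)) continuous_const
  refine (hopen.measure_pos _ ⟨S.axis j, ?_⟩).trans_le (measure_mono fun p hp =>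
    show (S.α : ℝ) * InnerProductGeometry.angle (p : E3) (S.axis j : E3) ≤ (S.α₁ : ℝ) / 2 from
      le_of_lt hp)
  have h1 : (0 : ℝ) < S.α₁ := by exact_mod_cast S.α₁_pos
  have h0 : (S.axis j : E3) ≠ 0 := by
    intro h
    simpa [h] using norm_eq_of_mem_sphere (S.axis j)
  simp only [Set.mem_ofPred_eq, InnerProductGeometry.angle_self h0]
  linarith

/-- Finitely many labels give one lower bound for all cap areas; through `κ` the caps enter the
probability estimates. -/
lemma exists_le_toSphere_cap :
    ∃ κ : ℝ, 0 < κ ∧ ∀ j, ENNReal.ofReal κ ≤ (volume : Measure E3).toSphere (S.cap j) := by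
  have h1 : ∀ᶠ κ : ℝ in nhdsWithin 0 (Set.Ioi 0),
      ∀ j, κ ≤ ((volume : Measure E3).toSphere (S.cap j)).toReal := by
    refine Filter.eventually_all.2 fun j => ?_
    have : 0 < ((volume : Measure E3).toSphere (S.cap j)).toReal :=
      ENNReal.toReal_pos (S.toSphere_cap_pos j).ne' (measure_ne_top _ _)
    filter_upwards [Ioo_mem_nhdsGT this] with κ h using h.2.le
  obtain ⟨κ, h, hκ⟩ := (h1.and self_mem_nhdsWithin).exists
  exact ⟨κ, hκ, fun j => ENNReal.ofReal_le_of_le_toReal (h j)⟩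

/-- The uniform law on the cap with label `j`. -/
noncomputable abbrev capLaw (j : Fin A) : Measure (Metric.sphere (0 : E3) 1) :=
  ProbabilityTheory.cond (volume : Measure E3).toSphere (S.cap j)

instance (j : Fin A) : IsProbabilityMeasure (S.capLaw j) :=
  ProbabilityTheory.cond_isProbabilityMeasure (S.toSphere_cap_pos j).ne'

lemma capLaw_sphereZone_le {κ : ℝ} (hκ : 0 < κ)
    (h : ∀ j, ENNReal.ofReal κ ≤ (volume : Measure E3).toSphere (S.cap j)) (j : Fin A)
    (n : E3) (hn : ‖n‖ = 1) (a ε : ℝ) (hε : 0 ≤ ε) (hε1 : ε ≤ 1) :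
    S.capLaw j (sphereZone n a ε) ≤ ENNReal.ofReal (96 / κ * √ε) := by
  rw [capLaw, ProbabilityTheory.cond_apply (S.isClosed_cap j).measurableSet]
  have h1 : ((volume : Measure E3).toSphere (S.cap j))⁻¹ ≤ ENNReal.ofReal κ⁻¹ := by
    rw [ENNReal.ofReal_inv_of_pos hκ]
    exact ENNReal.inv_le_inv.2 (h j)
  refine (mul_le_mul' h1 ((measure_mono Set.inter_subset_right).trans
    (toSphere_sphereZone_le n hn a ε hε hε1))).trans (le_of_eq ?_)
  rw [← ENNReal.ofReal_mul (by positivity)]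
  congr 1
  ring

end CapSystem

/-! ### Colouring, disjoint subfamilies and incidence counts. -/

/-- Greedy colouring of a finite graph of bounded degree. -/
lemma exists_coloring_of_degree_le {V : Type*} [Finite V] (G : SimpleGraph V) (k : ℕ)
    (h : ∀ v, (G.neighborSet v).ncard ≤ k) :
    ∃ lab : V → Fin (k + 1), ∀ u w, G.Adj u w → lab u ≠ lab w := by
  classical
  have := Fintype.ofFinite V
  suffices H : ∀ s : Finset V, ∃ lab : V → Fin (k + 1),
      ∀ u ∈ s, ∀ w ∈ s, G.Adj u w → lab u ≠ lab w by
    obtain ⟨lab, hl⟩ := H Finset.univ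
    exact ⟨lab, fun u w => hl u (Finset.mem_univ _) w (Finset.mem_univ _)⟩
  intro s
  induction s using Finset.induction_on with
  | empty => exact ⟨fun _ => 0, by simp⟩
  | insert a s ha ih =>
    obtain ⟨lab, hl⟩ := ih
    obtain ⟨col, hcol⟩ : ∃ col, col ∉ lab '' G.neighborSet a := by
      by_contra hcon
      push Not at hcon
      have h1 : lab '' G.neighborSet a = Set.univ := Set.eq_univ_of_forall hcon
      have h2 := (Set.ncard_image_le (f := lab) (Set.toFinite (G.neighborSet a))).trans (h a)
      rw [h1, Set.ncard_univ, Nat.card_fin] at h2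
      omega
    refine ⟨Function.update lab a col, fun u hu w hw huw => ?_⟩
    have hcol' (z : V) (hz : G.Adj a z) : col ≠ lab z := fun he => hcol ⟨z, hz, he.symm⟩
    rcases eq_or_ne u a with rfl | hua
    · rw [Function.update_self, Function.update_of_ne huw.ne']
      exact hcol' w huw
    · rw [Function.update_of_ne hua]
      rcases eq_or_ne w a with rfl | hwa
      · rw [Function.update_self]
        exact (hcol' u huw.symm).symm
      · rw [Function.update_of_ne hwa]
        exact hl u (Finset.mem_of_mem_insert_of_ne hu hua) w
          (Finset.mem_of_mem_insert_of_ne hw hwa) huw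

/-- A large family of sets, each of which meets few others, has many disjoint members. -/
lemma exists_pairwiseDisjoint_subset {F V : Type*} [Finite F] (W : F → Finset V)
    (hW : ∀ f, (W f).Nonempty) (D : ℕ) (hc : ∀ f, {g | ¬ Disjoint (W f) (W g)}.ncard ≤ D) (m : ℕ)
    (H : Finset F) (hH : m * (D + 1) ≤ H.card) :
    ∃ Q ⊆ H, Q.card = m ∧ (Q : Set F).PairwiseDisjoint W := by
  classical
  induction m generalizing H with
  | zero => exact ⟨∅, by simp⟩
  | succ m ih =>
    -- Choosing `f` discards at most `D` members, `f` included. The summand 1 in `D + 1` guarantees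
    -- that there is a member to choose even if `D = 0`.
    obtain ⟨f, hf⟩ : H.Nonempty := Finset.card_pos.1 (by nlinarith)
    have hfilter : (H.filter fun g => ¬ Disjoint (W f) (W g)).card ≤ D := by
      refine le_trans ?_ (hc f)
      rw [← Set.ncard_coe_finset]
      exact Set.ncard_le_ncard (by intro g; simp) (Set.toFinite _)
    have hadd := H.card_filter_add_card_filter_not (fun g => Disjoint (W f) (W g))
    rw [add_mul, one_mul] at hH
    obtain ⟨Q, hQ, hQc, hQd⟩ := ih (H.filter fun g => Disjoint (W f) (W g)) (by omega)
    have hfQ : f ∉ Q := by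
      intro h
      have := (Finset.mem_filter.1 (hQ h)).2
      rw [Finset.disjoint_self_iff_empty] at this
      exact (hW f).ne_empty this
    refine ⟨insert f Q, ?_, by rw [Finset.card_insert_of_notMem hfQ, hQc], ?_⟩
    · exact Finset.insert_subset hf (hQ.trans (Finset.filter_subset _ _))
    · rw [Finset.coe_insert]
      refine hQd.insert fun g hg _ => ?_
      exact (Finset.mem_filter.1 (hQ hg)).2

namespace SquareComplex

variable {V F : Type*} (T : SquareComplex V F)

/-- Each square at `v` contains the edge from `v` to the next corner, so squares can be counted
through the edges at `v`. -/
lemma ncard_facesAt_le [Finite V] [Finite F] {zv ze : ℕ} (hT : T.DegreesLE zv ze) (v : V) :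
    {f | ∃ i, T.corner f i = v}.ncard ≤ zv * ze := by
  classical
  have hfin : (T.graph.neighborSet v).Finite := Set.toFinite _
  have hsub : {f | ∃ i, T.corner f i = v} ⊆
      ⋃ w ∈ hfin.toFinset, {f | T.Incident f v w} := by
    rintro f ⟨i, rfl⟩
    exact Set.mem_iUnion₂.2 ⟨T.corner f (i + 1), by simpa using T.corner_adj f i, i, rfl⟩
  refine (Set.ncard_le_ncard hsub (Set.toFinite _)).trans
    ((Finset.set_ncard_biUnion_le _ _).trans ?_)
  refine (Finset.sum_le_card_nsmul _ _ ze fun w hw => hT.2 v w (by simpa using hw)).trans ?_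
  rw [smul_eq_mul, ← Set.ncard_eq_toFinset_card _ hfin]
  exact Nat.mul_le_mul_right _ (hT.1 v)

/-- Adding the diagonals to the graph raises the degree of `v` by at most the number of squares at
`v`, since each contributes at most one diagonal there. -/
lemma exists_isProperLabelling [Finite V] [Finite F] {zv ze : ℕ} (hT : T.DegreesLE zv ze) :
    ∃ lab : V → Fin (zv + zv * ze + 1), T.IsProperLabelling lab := by
  classical
  let G : SimpleGraph V := T.graph ⊔
    SimpleGraph.fromRel fun u w => ∃ f, u = T.corner f 0 ∧ w = T.corner f 2
  obtain ⟨lab, hl⟩ := exists_coloring_of_degree_le G (zv + zv * ze) (by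
    intro v
    have hsub : G.neighborSet v ⊆ T.graph.neighborSet v ∪
        (fun f => if T.corner f 0 = v then T.corner f 2 else T.corner f 0) ''
          {f | ∃ i, T.corner f i = v} := by
      intro w hw
      have hw' : T.graph.Adj v w ∨ (v ≠ w ∧ ((∃ f, v = T.corner f 0 ∧ w = T.corner f 2) ∨
        ∃ f, w = T.corner f 0 ∧ v = T.corner f 2)) := by simpa [G] using hw
      rcases hw' with h | ⟨-, ⟨f, h1, h2⟩ | ⟨f, h1, h2⟩⟩
      · exact Or.inl h
      · exact Or.inr ⟨f, ⟨0, h1.symm⟩, by simp [h1, h2]⟩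
      · refine Or.inr ⟨f, ⟨2, h2.symm⟩, ?_⟩
        have : T.corner f 0 ≠ T.corner f 2 := (T.corner_injective f).ne (by decide)
        simp [h1, h2, this]
    refine (Set.ncard_le_ncard hsub (Set.toFinite _)).trans ((Set.ncard_union_le _ _).trans ?_)
    exact add_le_add (hT.1 v)
      ((Set.ncard_image_le (Set.toFinite _)).trans (T.ncard_facesAt_le hT v)))
  refine ⟨lab, fun u w h => hl u w (Or.inl h), fun f => hl _ _ (Or.inr ?_)⟩
  exact (SimpleGraph.fromRel_adj _ _ _).2
    ⟨(T.corner_injective f).ne (by decide), Or.inl ⟨f, rfl, rfl⟩⟩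

/-- The vertices of a square. -/
def corners (f : F) : Finset V := Finset.univ.map ⟨T.corner f, T.corner_injective f⟩

lemma mem_corners {f : F} {v : V} : v ∈ T.corners f ↔ ∃ i, T.corner f i = v := by
  simp [corners]

lemma ncard_meeting_le [Finite V] [Finite F] {zv ze : ℕ} (hT : T.DegreesLE zv ze) (f : F) :
    {g | ¬ Disjoint (T.corners f) (T.corners g)}.ncard ≤ 4 * (zv * ze) := by
  classical
  have hsub : {g | ¬ Disjoint (T.corners f) (T.corners g)} ⊆
      ⋃ v ∈ T.corners f, {g | ∃ i, T.corner g i = v} := by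
    intro g hg
    obtain ⟨v, hv, hv'⟩ := Finset.not_disjoint_iff.1 hg
    exact Set.mem_iUnion₂.2 ⟨v, hv, T.mem_corners.1 hv'⟩
  refine (Set.ncard_le_ncard hsub (Set.toFinite _)).trans
    ((Finset.set_ncard_biUnion_le _ _).trans ?_)
  refine (Finset.sum_le_card_nsmul _ _ _ fun v _ => T.ncard_facesAt_le hT v).trans ?_
  simp [corners]

end SquareComplex

/-! ### Hit events and bad events. -/

namespace CapSystem

variable {A : ℕ} (S : CapSystem A) {V F : Type*} (T : SquareComplex V F)

/-- The perturbations that move the square `f` to within distance `r` of `x`. -/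
def hitEvent (lam : ℝ) (I : V → E3) (x : E3) (r : ℝ) (f : F) :
    Set (V → Metric.sphere (0 : E3) 1) :=
  ⋃ h, ⋃ i, (fun c j => S.perturb lam I c (T.corner f (halfSquare h j))) ⁻¹' triangleHit i x r

lemma mem_hitEvent {lam : ℝ} {I : V → E3} {x : E3} {r : ℝ} {f : F}
    {c : V → Metric.sphere (0 : E3) 1}
    (h : (T.cellImage (S.perturb lam I c) f ∩ Metric.closedBall x r).Nonempty) :
    c ∈ S.hitEvent T lam I x r f := by
  obtain ⟨p, hp, hpx⟩ := h
  rw [T.cellImage_eq, Set.mem_iUnion] at hp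
  obtain ⟨k, hk⟩ := hp
  obtain ⟨i, hi⟩ := exists_triangleHit_of_convexHull _ x r ⟨p, hk, hpx⟩
  exact Set.mem_iUnion₂.2 ⟨k, i, hi⟩

lemma measurable_perturb_corner (lam : ℝ) (I : V → E3) (f : F) (h : Fin 2) :
    Measurable[coordSigma (T.corners f)] (fun (c : V → Metric.sphere (0 : E3) 1) (j : Fin 3) =>
      S.perturb lam I c (T.corner f (halfSquare h j))) := by
  refine @measurable_pi_lambda _ _ _ (coordSigma (T.corners f)) _ _ fun j => ?_
  have h1 : Measurable fun p : Metric.sphere (0 : E3) 1 =>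
      lam • I (T.corner f (halfSquare h j)) + ((S.α : ℝ) * lam) • (p : E3) := by
    fun_prop
  exact h1.comp (measurable_eval_coordSigma (T.mem_corners.2 ⟨_, rfl⟩))

lemma measurableSet_hitEvent (lam : ℝ) (I : V → E3) (x : E3) (r : ℝ) (f : F) :
    MeasurableSet[coordSigma (T.corners f)] (S.hitEvent T lam I x r f) :=
  MeasurableSet.iUnion fun h => MeasurableSet.iUnion fun i =>
    S.measurable_perturb_corner T lam I f h (isClosed_triangleHit i x r).measurableSet

section SevenSquares

variable [Fintype F]

open scoped Classical in
/-- The squares that a perturbation may move close to the lattice point `g`. -/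
noncomputable def nearSquares (lam : ℝ) (I : V → E3) (g : Fin 3 → ℤ) : Finset F :=
  {f | (T.cellImage I f ∩ Metric.closedBall (lam⁻¹ • latticePoint g) (S.α + 2)).Nonempty}

open scoped Classical in
/-- The families of seven disjoint squares that may be moved close to the lattice point `g`. -/
noncomputable def disjointFamilies (lam : ℝ) (I : V → E3) (g : Fin 3 → ℤ) : Finset (Finset F) :=
  {Q ∈ (S.nearSquares T lam I g).powersetCard 7 | (Q : Set F).PairwiseDisjoint T.corners}

/-- The event that seven disjoint squares come close to the lattice point `g`. -/
def badEvent (lam : ℝ) (I : V → E3) (g : Fin 3 → ℤ) : Set (V → Metric.sphere (0 : E3) 1) :=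
  ⋃ Q ∈ S.disjointFamilies T lam I g, ⋂ f ∈ Q, S.hitEvent T lam I (latticePoint g) 2 f

open scoped Classical in
/-- The vertices whose perturbation the event `badEvent` depends on. -/
noncomputable def badSupport (lam : ℝ) (I : V → E3) (g : Fin 3 → ℤ) : Finset V :=
  (S.nearSquares T lam I g).biUnion T.corners

lemma measurableSet_badEvent (lam : ℝ) (I : V → E3) (g : Fin 3 → ℤ) :
    MeasurableSet[coordSigma (S.badSupport T lam I g)] (S.badEvent T lam I g) := by
  classical
  refine Finset.measurableSet_biUnion _ fun Q hQ => Finset.measurableSet_biInter _ fun f hf => ?_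
  refine coordSigma_mono (Finset.subset_biUnion_of_mem T.corners ?_) _
    (S.measurableSet_hitEvent T lam I _ 2 f)
  exact (Finset.mem_powersetCard.1 (Finset.mem_filter.1 hQ).1).1 hf

lemma dist_latticePoint_le_of_mem_badSupport {lam t : ℝ} (hlam : 0 < lam) {I : V → E3}
    (hI : T.IsEmbedding I t 1) {g : Fin 3 → ℤ} {v : V} (hv : v ∈ S.badSupport T lam I g) :
    dist (latticePoint g) (lam • I v) ≤ (S.α + 4) * lam := by
  classical
  obtain ⟨f, hf, hvf⟩ := Finset.mem_biUnion.1 hv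
  obtain ⟨i, rfl⟩ := T.mem_corners.1 hvf
  have h := T.dist_corner_le_of_near hI (Finset.mem_filter.1 hf).2 i
  have e : latticePoint g = lam • lam⁻¹ • latticePoint g := by
    rw [smul_smul, mul_inv_cancel₀ hlam.ne', one_smul]
  rw [e, dist_smul₀, Real.norm_of_nonneg hlam.le, dist_comm]
  nlinarith

/-- Bad events at lattice points far from every scaled vertex are empty. Hence finitely many lattice
points suffice for the local lemma. -/
lemma badSupport_nonempty_of_mem_badEvent {lam : ℝ} {I : V → E3} {g : Fin 3 → ℤ}
    {c : V → Metric.sphere (0 : E3) 1} (h : c ∈ S.badEvent T lam I g) :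
    (S.badSupport T lam I g).Nonempty := by
  classical
  obtain ⟨Q, hQ, -⟩ := Set.mem_iUnion₂.1 h
  obtain ⟨h1, h2⟩ := Finset.mem_powersetCard.1 (Finset.mem_filter.1 hQ).1
  obtain ⟨f, hf⟩ : Q.Nonempty := Finset.card_pos.1 (by omega)
  exact ⟨T.corner f 0, Finset.mem_biUnion.2 ⟨f, h1 hf, T.mem_corners.2 ⟨0, rfl⟩⟩⟩

end SevenSquares

/-! ### Probability estimates. -/

variable [Fintype V]

/-- All vertices but the `i`-th are frozen. The slab of half-width `3 * r` for its position becomes,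
after division by the radius `α * lam`, a zone for its direction. -/
lemma perturbationLaw_triangleHit_le {κ : ℝ} (hκ : 0 < κ)
    (hS : ∀ j, ENNReal.ofReal κ ≤ (volume : Measure E3).toSphere (S.cap j)) (lab : V → Fin A)
    {lam : ℝ} {r : ℝ} (hr : 0 ≤ r) (hlam : 0 < lam) (hlamr : 3 * r ≤ S.α * lam)
    (I : V → E3) (x : E3) (f : F) (h : Fin 2) (i : Fin 3) :
    S.perturbationLaw lab
      ((fun c j => S.perturb lam I c (T.corner f (halfSquare h j))) ⁻¹' triangleHit i x r) ≤
        ENNReal.ofReal (96 / κ * √(3 * r / (S.α * lam))) := by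
  classical
  have hα := S.alpha_pos
  have hR : 0 < S.α * lam := by positivity
  refine pi_le_of_section_le (fun v => S.capLaw (lab v)) (T.corner f (halfSquare h i))
    (coordSigma_le _ _ (S.measurable_perturb_corner T lam I f h
      (isClosed_triangleHit i x r).measurableSet)) _ fun c => ?_
  obtain ⟨n, b, hn, hnb⟩ := exists_slab_of_triangleHit i x r
    (fun j => S.perturb lam I c (T.corner f (halfSquare h j)))
  set v := T.corner f (halfSquare h i) with hv
  refine (measure_mono ?_).trans (S.capLaw_sphereZone_le hκ hS (lab v) n hn
    ((b - lam * inner ℝ n (I v)) / (S.α * lam)) (3 * r / (S.α * lam)) (by positivity)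
    ((div_le_one hR).2 hlamr))
  intro y hy
  have hy' : (fun j => S.perturb lam I (Function.update c v y) (T.corner f (halfSquare h j))) ∈
    triangleHit i x r := hy
  have he : (fun j => S.perturb lam I (Function.update c v y) (T.corner f (halfSquare h j))) =
      Function.update (fun j => S.perturb lam I c (T.corner f (halfSquare h j))) i
        (lam • I v + ((S.α : ℝ) * lam) • (y : E3)) := by
    funext j
    rcases eq_or_ne j i with rfl | hj
    · simp [perturb, hv]
    -- Distinct corners are distinct vertices, so resampling `v` moves only one vertex of the
    -- triangle.
    · have : T.corner f (halfSquare h j) ≠ v :=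
        fun e => hj (halfSquare_injective h (T.corner_injective f e))
      rw [Function.update_of_ne hj]
      simp [perturb, Function.update_of_ne this]
  rw [he] at hy'
  have h1 := hnb _ hy'
  rw [inner_add_right, real_inner_smul_right, real_inner_smul_right] at h1
  change |inner ℝ n (y : E3) - (b - lam * inner ℝ n (I v)) / (S.α * lam)| ≤ 3 * r / (S.α * lam)
  have e2 : inner ℝ n (y : E3) - (b - lam * inner ℝ n (I v)) / (S.α * lam) =
      (lam * inner ℝ n (I v) + S.α * lam * inner ℝ n (y : E3) - b) / (S.α * lam) := by
    field_simp
    ring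
  rw [e2, abs_div, abs_of_pos hR]
  exact div_le_div_of_nonneg_right h1 hR.le

lemma perturbationLaw_hitEvent_le {κ : ℝ} (hκ : 0 < κ)
    (hS : ∀ j, ENNReal.ofReal κ ≤ (volume : Measure E3).toSphere (S.cap j)) (lab : V → Fin A)
    {lam : ℝ} (hlam : 6 ≤ lam) (I : V → E3) (x : E3) (f : F) :
    (S.perturbationLaw lab).real (S.hitEvent T lam I x 2 f) ≤ 1728 / κ / √lam := by
  have hα : (1 : ℝ) ≤ S.α := by exact_mod_cast (Nat.cast_pos.1 S.alpha_pos : 0 < S.α)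
  have hlam0 : 0 < lam := by linarith
  have hq : 96 / κ * √(3 * 2 / (S.α * lam)) ≤ 288 / κ / √lam := by
    have h1 : √(3 * 2 / (S.α * lam)) ≤ 3 / √lam := by
      rw [Real.sqrt_le_left (by positivity), div_pow, Real.sq_sqrt hlam0.le,
        div_le_div_iff₀ (by positivity) hlam0]
      nlinarith
    calc 96 / κ * √(3 * 2 / (S.α * lam)) ≤ 96 / κ * (3 / √lam) :=
          mul_le_mul_of_nonneg_left h1 (by positivity)
      _ = 288 / κ / √lam := by ring
  have h3 (h : Fin 2) (i : Fin 3) : (S.perturbationLaw lab).real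
      ((fun c j => S.perturb lam I c (T.corner f (halfSquare h j))) ⁻¹' triangleHit i x 2) ≤
        288 / κ / √lam := by
    refine ENNReal.toReal_le_of_le_ofReal (by positivity) ?_
    exact (S.perturbationLaw_triangleHit_le T hκ hS lab (by norm_num) hlam0 (by nlinarith)
      I x f h i).trans (ENNReal.ofReal_le_ofReal hq)
  rw [hitEvent]
  refine (measureReal_iUnion_fintype_le _).trans ?_
  -- Two triangles with three vertices each: `1728 = 6 * 288`.
  refine (Finset.sum_le_sum fun h _ => (measureReal_iUnion_fintype_le _).trans
    (Finset.sum_le_sum fun i _ => h3 h i)).trans (le_of_eq ?_)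
  simp only [Finset.sum_const, Finset.card_univ, Fintype.card_fin, nsmul_eq_mul]
  push_cast
  ring

section SevenSquares

variable [Fintype F]

lemma perturbationLaw_badEvent_le {κ : ℝ} (hκ : 0 < κ)
    (hS : ∀ j, ENNReal.ofReal κ ≤ (volume : Measure E3).toSphere (S.cap j)) (lab : V → Fin A)
    {lam : ℝ} (hlam : 6 ≤ lam) (I : V → E3) (g : Fin 3 → ℤ) {M : ℝ}
    (hM : ((S.nearSquares T lam I g).card : ℝ) ≤ M) :
    (S.perturbationLaw lab).real (S.badEvent T lam I g) ≤ (M * (1728 / κ) / √lam) ^ 7 := by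
  classical
  have hQ : ∀ Q ∈ S.disjointFamilies T lam I g, (S.perturbationLaw lab).real
      (⋂ f ∈ Q, S.hitEvent T lam I (latticePoint g) 2 f) ≤ (1728 / κ / √lam) ^ 7 := by
    intro Q hQ
    obtain ⟨h1, h2⟩ := Finset.mem_filter.1 hQ
    -- Squares with disjoint corner sets depend on disjoint sets of coordinates, hence the product.
    have h3 := pi_biInter_eq_prod (fun v => S.capLaw (lab v)) Q T.corners h2
      (fun f => S.hitEvent T lam I (latticePoint g) 2 f)
      fun f _ => S.measurableSet_hitEvent T lam I _ 2 f
    rw [measureReal_def, show S.perturbationLaw lab = Measure.pi fun v => S.capLaw (lab v) from rfl,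
      h3, ENNReal.toReal_prod, ← (Finset.mem_powersetCard.1 h1).2]
    exact (Finset.prod_le_prod (fun f _ => ENNReal.toReal_nonneg)
      fun f _ => S.perturbationLaw_hitEvent_le T hκ hS lab hlam I _ f).trans_eq (Finset.prod_const _)
  have hcard : ((S.disjointFamilies T lam I g).card : ℝ) ≤ M ^ 7 := by
    have h1 : (S.disjointFamilies T lam I g).card ≤ (S.nearSquares T lam I g).card ^ 7 := by
      refine (Finset.card_filter_le _ _).trans ?_
      rw [Finset.card_powersetCard]
      exact Nat.choose_le_pow _ _
    calc ((S.disjointFamilies T lam I g).card : ℝ) ≤ ((S.nearSquares T lam I g).card : ℝ) ^ 7 := by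
          exact_mod_cast h1
      _ ≤ M ^ 7 := pow_le_pow_left₀ (by positivity) hM 7
  calc (S.perturbationLaw lab).real (S.badEvent T lam I g)
      ≤ ∑ Q ∈ S.disjointFamilies T lam I g, (S.perturbationLaw lab).real
          (⋂ f ∈ Q, S.hitEvent T lam I (latticePoint g) 2 f) := measureReal_biUnion_finset_le _ _
    _ ≤ (S.disjointFamilies T lam I g).card • (1728 / κ / √lam) ^ 7 :=
        Finset.sum_le_card_nsmul _ _ _ hQ
    _ ≤ M ^ 7 * (1728 / κ / √lam) ^ 7 := by
        rw [nsmul_eq_mul]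
        exact mul_le_mul_of_nonneg_right hcard (by positivity)
    _ = (M * (1728 / κ) / √lam) ^ 7 := by ring

/-- With positive probability no bad event occurs. -/
lemma perturbationLaw_avoid_pos {κ : ℝ} (hκ : 0 < κ)
    (hS : ∀ j, ENNReal.ofReal κ ≤ (volume : Measure E3).toSphere (S.cap j)) (lab : V → Fin A)
    {lam t M : ℝ} (hlam : 6 ≤ lam) {I : V → E3} (hI : T.IsEmbedding I t 1)
    (hM : ∀ g, ((S.nearSquares T lam I g).card : ℝ) ≤ M)
    (hlamM : 4 * (4 * S.α + 17) ^ 3 * (M * (1728 / κ)) ^ 7 ≤ √lam) (G : Finset (Fin 3 → ℤ)) :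
    0 < (S.perturbationLaw lab).real (⋂ g ∈ G, (S.badEvent T lam I g)ᶜ) := by
  have hlam0 : 0 < lam := by linarith
  have hα := S.alpha_pos
  have hM0 : 0 ≤ M := (Nat.cast_nonneg _).trans (hM 0)
  refine lovaszLocalLemma (fun v => S.capLaw (lab v)) (S.badSupport T lam I)
    (S.badEvent T lam I) (S.measurableSet_badEvent T lam I) ((M * (1728 / κ) / √lam) ^ 7)
    ((⌊2 * (2 * ((S.α + 4) * lam))⌋₊ + 1) ^ 3)
    (fun g => S.perturbationLaw_badEvent_le T hκ hS lab hlam I g (hM g))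
    (fun g => latticeCube (latticePoint g) (2 * ((S.α + 4) * lam))) ?_
    (fun g => card_latticeCube_le _ _ (by positivity)) (Nat.one_le_pow _ _ (by omega)) ?_ G
  -- A common vertex `v` puts both lattice points within `(α + 4) * lam` of `lam • I v`.
  · intro g g' h
    obtain ⟨v, hv, hv'⟩ := Finset.not_disjoint_iff.1 h
    refine mem_latticeCube ?_
    have h1 := S.dist_latticePoint_le_of_mem_badSupport T hlam0 hI hv
    have h2 := S.dist_latticePoint_le_of_mem_badSupport T hlam0 hI hv'
    linarith [dist_triangle_right (latticePoint g') (latticePoint g) (lam • I v)]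
  · have hs : 0 < √lam := Real.sqrt_pos.2 hlam0
    have hss : √lam ^ 2 = lam := Real.sq_sqrt hlam0.le
    -- The dependency degree is of order `√lam ^ 6` and the probability of order `√lam ^ (-7)`; the
    -- spare factor `1 / √lam` absorbs the constants.
    have hd : (((⌊2 * (2 * ((S.α + 4) * lam))⌋₊ + 1) ^ 3 : ℕ) : ℝ) ≤
        ((4 * S.α + 17) * √lam ^ 2) ^ 3 := by
      push_cast
      refine pow_le_pow_left₀ (by positivity) ?_ 3
      have := Nat.floor_le (show 0 ≤ 2 * (2 * ((S.α + 4) * lam)) by positivity)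
      rw [hss]
      linarith
    have hp : 0 ≤ (M * (1728 / κ) / √lam) ^ 7 := by positivity
    calc 4 * (((⌊2 * (2 * ((S.α + 4) * lam))⌋₊ + 1) ^ 3 : ℕ) : ℝ) * (M * (1728 / κ) / √lam) ^ 7
        ≤ 4 * ((4 * S.α + 17) * √lam ^ 2) ^ 3 * (M * (1728 / κ) / √lam) ^ 7 := by gcongr
      _ = 4 * (4 * S.α + 17) ^ 3 * (M * (1728 / κ)) ^ 7 / √lam := by field_simp
      _ ≤ 1 := (div_le_one hs).2 hlamM

lemma isEmbedding_perturb_of_avoid {zv ze : ℕ} (hT : T.DegreesLE zv ze) {lam t t' : ℝ}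
    (hlam : 1 ≤ lam) (ht' : 7 * (4 * (zv * ze) + 1) ≤ t') {I : V → E3} (hI : T.IsEmbedding I t 1)
    {c : V → Metric.sphere (0 : E3) 1} (hc : ∀ g, c ∉ S.badEvent T lam I g) :
    T.IsEmbedding (S.perturb lam I c) t' ((2 * (S.α : ℝ) + 1) * lam) := by
  classical
  refine ⟨fun x => ?_, S.perturb_locality T (by linarith) hI c⟩
  by_contra hcon
  push Not at hcon
  obtain ⟨g, hg⟩ := exists_latticePoint_near x
  have hfin : {f | (T.cellImage (S.perturb lam I c) f ∩ Metric.closedBall x 1).Nonempty}.Finite :=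
    Set.toFinite _
  have hcard : 7 * (4 * (zv * ze) + 1) ≤ hfin.toFinset.card := by
    rw [Set.ncard_eq_toFinset_card _ hfin] at hcon
    exact_mod_cast ht'.trans hcon.le
  obtain ⟨Q, hQ, hQ7, hQd⟩ := exists_pairwiseDisjoint_subset T.corners
    (fun f => ⟨_, T.mem_corners.2 ⟨0, rfl⟩⟩) _ (T.ncard_meeting_le hT) 7 _ hcard
  -- Radius 2 is the unit radius plus the distance, at most 1, from `x` to the lattice point.
  have hhit : ∀ f ∈ Q, (T.cellImage (S.perturb lam I c) f ∩
      Metric.closedBall (latticePoint g) 2).Nonempty := by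
    intro f hf
    have h1 : (T.cellImage (S.perturb lam I c) f ∩ Metric.closedBall x 1).Nonempty := by
      simpa using hQ hf
    refine h1.mono (Set.inter_subset_inter_right _ (Metric.closedBall_subset_closedBall' ?_))
    linarith
  refine hc g (Set.mem_iUnion₂.2 ⟨Q, Finset.mem_filter.2 ⟨Finset.mem_powersetCard.2 ⟨?_, hQ7⟩, hQd⟩,
    Set.mem_iInter₂.2 fun f hf => S.mem_hitEvent T (hhit f hf)⟩)
  intro f hf
  exact Finset.mem_filter.2 ⟨Finset.mem_univ _,
    S.near_of_perturb_near T hlam I c f _ 2 (hhit f hf)⟩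

theorem perturbationLaw_isEmbedding_pos {zv ze : ℕ} (hT : T.DegreesLE zv ze) {κ : ℝ} (hκ : 0 < κ)
    (hS : ∀ j, ENNReal.ofReal κ ≤ (volume : Measure E3).toSphere (S.cap j)) (lab : V → Fin A)
    {lam t t' M : ℝ} (hlam : 6 ≤ lam) (ht' : 7 * (4 * (zv * ze) + 1) ≤ t') {I : V → E3}
    (hI : T.IsEmbedding I t 1) (hM : ∀ g, ((S.nearSquares T lam I g).card : ℝ) ≤ M)
    (hlamM : 4 * (4 * S.α + 17) ^ 3 * (M * (1728 / κ)) ^ 7 ≤ √lam) :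
    0 < S.perturbationLaw lab
      {c | T.IsEmbedding (S.perturb lam I c) t' ((2 * (S.α : ℝ) + 1) * lam)} := by
  classical
  let G : Finset (Fin 3 → ℤ) :=
    Finset.univ.biUnion fun v => latticeCube (lam • I v) ((S.α + 4) * lam)
  have h := S.perturbationLaw_avoid_pos T hκ hS lab hlam hI hM hlamM G
  refine (ENNReal.toReal_pos_iff.1 h).1.trans_le (measure_mono fun c hc => ?_)
  refine S.isEmbedding_perturb_of_avoid T hT (by linarith) ht' hI fun g hg => ?_
  obtain ⟨v, hv⟩ := S.badSupport_nonempty_of_mem_badEvent T hg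
  have hgG : g ∈ G := Finset.mem_biUnion.2 ⟨v, Finset.mem_univ _, mem_latticeCube
    (S.dist_latticePoint_le_of_mem_badSupport T (by linarith) hI hv)⟩
  exact Set.mem_iInter₂.1 hc g hgG hg

end SevenSquares

lemma ae_mem_cap (lab : V → Fin A) :
    ∀ᵐ c ∂S.perturbationLaw lab, ∀ v, c v ∈ S.cap (lab v) := by
  refine Filter.eventually_all.2 fun v => ?_
  have h : ∀ᵐ p ∂S.capLaw (lab v), p ∈ S.cap (lab v) :=
    ProbabilityTheory.ae_cond_mem (S.isClosed_cap (lab v)).measurableSet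
  exact (Measure.tendsto_eval_ae_ae (μ := fun v => S.capLaw (lab v)) (i := v)).eventually h

end CapSystem

/-! ### Choice of the constants. -/

theorem mainTheorem6 (zv ze : ℕ) :
    ∃ (A : ℕ) (S : CapSystem A) (t₀ : ℝ), 1 < A ∧ 0 < t₀ ∧
      ∀ t' t : ℝ, t₀ ≤ t' → t' < t →
        ∃ lam₀ : ℝ, 1 ≤ lam₀ ∧ ∀ lam : ℝ, lam₀ ≤ lam →
          ∃ ℓ : ℝ, 1 < ℓ ∧ ℓ = (2 * (S.α : ℝ) + 1) * lam ∧
            ∀ (V F : Type*) [Fintype V] [Fintype F] (T : SquareComplex V F) (I : V → E3),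
              T.DegreesLE zv ze → T.IsEmbedding I t 1 →
                ∃ lab : V → Fin A, T.IsProperLabelling lab ∧
                  0 < S.perturbationLaw lab {c | T.IsEmbedding (S.perturb lam I c) t' ℓ} ∧
                  ∃ c : V → Metric.sphere (0 : E3) 1, (∀ v, c v ∈ S.cap (lab v)) ∧
                    T.IsEmbedding (S.perturb lam I c) t' ℓ := by
  -- One label beyond what the colouring needs ensures `1 < A` even when `zv = 0`; `Fin.castSucc`
  -- embeds the colours.
  obtain ⟨S⟩ := exists_capSystem (zv + zv * ze + 1 + 1)
  obtain ⟨κ, hκ, hS⟩ := S.exists_le_toSphere_cap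
  obtain ⟨Z, hZ⟩ := exists_finset_cover (S.α + 2)
  have hα := S.alpha_pos
  refine ⟨_, S, 7 * (4 * (zv * ze) + 1), by omega, by positivity, fun t' t ht' _ => ?_⟩
  set C : ℝ := 4 * (4 * S.α + 17) ^ 3 * (Z.card * t * (1728 / κ)) ^ 7
  -- The threshold gives both `6 ≤ lam` and `C ≤ √lam`, the latter being the local lemma condition.
  refine ⟨6 + C ^ 2, by nlinarith [sq_nonneg C], fun lam hlam => ⟨_, ?_, rfl, ?_⟩⟩
  · nlinarith [sq_nonneg C]
  intro V F _ _ T I hT hI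
  have hlam6 : 6 ≤ lam := by nlinarith [sq_nonneg C]
  obtain ⟨lab, hlab⟩ := T.exists_isProperLabelling hT
  have hpos := S.perturbationLaw_isEmbedding_pos T hT hκ hS (fun v => (lab v).castSucc) hlam6 ht' hI
    (M := Z.card * t) (fun g => by
      classical
      refine le_trans (le_of_eq ?_) (T.ncard_near_le hI hZ (lam⁻¹ • latticePoint g))
      rw [← Set.ncard_coe_finset]
      simp [CapSystem.nearSquares])
    (Real.le_sqrt_of_sq_le (by linarith))
  refine ⟨fun v => (lab v).castSucc, ⟨fun u w h => ?_, fun f => ?_⟩, hpos, ?_⟩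
  · exact (Fin.castSucc_injective _).ne (hlab.1 u w h)
  · exact (Fin.castSucc_injective _).ne (hlab.2 f)
  -- An event of positive probability meets the almost sure event that every direction lies in its
  -- cap.
  · obtain ⟨c, hc, hcap⟩ := (frequently_ae_mem_iff.2 hpos.ne').and_eventually
      (S.ae_mem_cap fun v => (lab v).castSucc) |>.exists
    exact ⟨c, hcap, hc⟩
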